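/- Let $\mathbb F=\mathbb Z/2$ and let $\mathcal R$ be the ring of long power series $\sum_{\alpha\in A}q^\alpha$ with coefficients in $\mathbb F$, where $A\subset[0,\infty)$ is well ordered. Let $\Gamma$ be a plumbing graph (a finite simple graph) with one unframed vertex $v_0$ and integer framings on the vertices of $G=\Gamma-v_0$; for example, a tree with $G$ negative definite. On the lattice freely generated by the vertices of $G$ let $\cdot$ be the intersection form: $u\cdot u$ is the framing of $u$, and for $u\ne w$ one has $u\cdot w=1$ if $u,w$ are adjacent and $0$ otherwise. Write $w^*$ for the functional $u\mapsto w\cdot u$, and $v_0^*$ for the functional that is $1$ on the vertices adjacent to $v_0$ and $0$ on the other vertices of $G$. Let $\mathrm{Char}(G)$ be the set of integral functionals $K$ with $K(w)\equiv w\cdot w \pmod 2$ for all $w\in G$. For $K\in\mathrm{Char}(G)$, sets $I,E$ of vertices of $G$, $w\in E$ and $t\in[0,2]$, put $2f_G(K,I)=\sum_{u\in I}K(u)+\big(\sum_{u\in I}u\big)^2$, $\ g_G[K,E]=\min_{I\subseteq E}f_G(K,I)$, $\ {}^tg_G[K,E]=(2-t)g_G[K,E]+t\,g_G[K+2v_0^*,E]$,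 $$a_w[K,E]=g_G[K,E-w]-g_G[K,E],\qquad b_w[K,E]=g_G[K+2w^*,E-w]-g_G[K,E]+\tfrac12\big(K(w)+w\cdot w\big),$$ $$a_w(t)=(2-t)a_w[K,E]+t\,a_w[K+2v_0^*,E],\qquad b_w(t)=(2-t)b_w[K,E]+t\,b_w[K+2v_0^*,E].$$ Let $\mathbb{CF}_t(\Gamma)$ be the chain complex of $\mathcal R$-modules that in degree $p$ is the direct product of copies of $\mathcal R$ over the generators $[K,E]$ with $|E|=p$, its elements being written as formal infinite sums, with differential $$\partial_t[K,E]=\sum_{w\in E}\Big(q^{a_w(t)}[K,E-w]+q^{b_w(t)}[K+2w^*,E-w]\Big)$$ extended to infinite sums, and let $t\mathbb{HFK}_p(\Gamma)=H_p(\mathbb{CF}_t(\Gamma))$. Let $v$ be a vertex of $G$ that is not adjacent to $v_0$, and let $\Gamma_{+1}(v)$ be obtained from $\Gamma$ by increasing the framing of $v$ by one. For $K\in \mathrm{Char}(G-v)$ let $(K,j)$ be its extension with value $j$ at $v$. Then for every $t\in[0,2]$ there is a short exact sequence of chain complexes of $\mathcal R$-modules $$0\to\mathbb{CF}_t(\Gamma-v)\xrightarrow{A_t}\mathbb{CF}_t(\Gamma)\xrightarrow{B_t}\mathbb{CF}_t(\Gamma_{+1}(v))\to0,$$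 where, extended to infinite sums, $$A_t[K,E]=\sum_{j\equiv v\cdot v\ (2)}[(K,j),E],\qquad B_t[(K,j),E]=\sum_{m\in\mathbb Z}q^{s_m(t)}[(K,j+2m-1),E],$$ $$s_m(t)={}^tg_{G_{+1}(v)}[(K,j+2m-1),E]-{}^tg_G[(K,j),E]+m(m-1)\ \ge 0$$ (the coefficients of $B_t$ of an infinite sum are locally finite sums of long power series: each power of $q$ occurs in only finitely many terms). With $\phi_*$ and $\psi_*$ the maps induced by $A_t$ and $B_t$, and $\delta$ the connecting homomorphism, the resulting sequence of $\mathcal R$-modules $$\cdots\to t\mathbb{HFK}_p(\Gamma-v)\xrightarrow{\phi_*}t\mathbb{HFK}_p(\Gamma)\xrightarrow{\psi_*}t\mathbb{HFK}_p(\Gamma_{+1}(v))\xrightarrow{\delta}t\mathbb{HFK}_{p-1}(\Gamma-v)\to\cdots$$ is exact ($p\in\mathbb Z$). -/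

import Mathlib

open CategoryTheory

universe u

noncomputable section

/-- The ring `ℛ` of long power series: formal sums `∑_{α ∈ A} q ^ α` over the field with two
elements, with `A ⊆ [0, ∞)` well ordered. -/
abbrev LongPowerSeries : Type := HahnSeries NNReal (ZMod 2)

/-- The monomial `q ^ α`. It is only used for exponents `α ≥ 0`. -/
def qPow (α : ℝ) : LongPowerSeries := HahnSeries.single α.toNNReal 1

theorem qPow_mul {α β : ℝ} (hα : 0 ≤ α) (hβ : 0 ≤ β) : qPow α * qPow β = qPow (α + β) := by
  rw [qPow, qPow, qPow, HahnSeries.single_mul_single, Real.toNNReal_add hα hβ, one_mul]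

theorem LongPowerSeries.add_self (x : LongPowerSeries) : x + x = 0 := by
  ext α
  rw [HahnSeries.coeff_add, HahnSeries.coeff_zero]
  exact CharTwo.add_self_eq_zero _

/-- A plumbing graph `Γ` with one unframed vertex `v₀`. The framed vertices form the type `V`,
the vertex `none` of the graph is `v₀`, and the full subgraph on `V` is `G = Γ - v₀`. -/
structure PlumbingGraph (V : Type u) where
  graph : SimpleGraph (Option V)
  framing : V → ℤ

namespace PlumbingGraph

variable {V : Type u}

/-- The graph `Γ - v`, for a framed vertex `v`. -/
def delete (Γ : PlumbingGraph V) (v : V) : PlumbingGraph {w : V // w ≠ v} where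
  graph := Γ.graph.comap (Option.map Subtype.val)
  framing w := Γ.framing w.1

/-- The graph `Γ_{+1}(v)`: the framing of `v` is increased by one. -/
def plusOne [DecidableEq V] (Γ : PlumbingGraph V) (v : V) : PlumbingGraph V where
  graph := Γ.graph
  framing := Function.update Γ.framing v (Γ.framing v + 1)

open Classical in
/-- The intersection form of `X(G)` on the basis of `H₂(X(G); ℤ) = ℤ ^ V` given by the
framed vertices. -/
def inter (Γ : PlumbingGraph V) (u w : V) : ℤ :=
  if u = w then Γ.framing u else if Γ.graph.Adj (some u) (some w) then 1 else 0

/-- `w ^*`, the Poincaré dual of the framed vertex `w`, as an element of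
`H²(X(G); ℤ) = Hom(ℤ ^ V, ℤ)`, recorded by its values on the basis. -/
def dual (Γ : PlumbingGraph V) (w : V) : V → ℤ := fun u => Γ.inter w u

open Classical in
/-- `v₀ ^*`: it is `1` on the framed vertices adjacent to `v₀`, and `0` on the others. -/
def dualZero (Γ : PlumbingGraph V) : V → ℤ := fun u => if Γ.graph.Adj none (some u) then 1 else 0

/-- Characteristic vectors of the intersection form: `K(w) ≡ w² (mod 2)` on the basis (hence
`K(x) ≡ x² (mod 2)` for all `x`). -/
def Char (Γ : PlumbingGraph V) : Type u := {K : V → ℤ // ∀ w, K w ≡ Γ.inter w w [ZMOD 2]}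

/-- `K + 2n w ^*` is characteristic if `K` is. -/
def Char.addDual {Γ : PlumbingGraph V} (K : Γ.Char) (n : ℤ) (w : V) : Γ.Char :=
  ⟨K.1 + (2 * n) • Γ.dual w, fun u => by
    have h : (K.1 + (2 * n) • Γ.dual w) u = K.1 u + 2 * (n * Γ.dual w u) := by
      simp only [Pi.add_apply, Pi.smul_apply, smul_eq_mul]; ring
    rw [h]
    exact (Int.modEq_add_fac_self (t := n * Γ.dual w u)).trans (K.2 u)⟩

theorem Char.addDual_comm {Γ : PlumbingGraph V} (K : Γ.Char) (n : ℤ) (u w : V) :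
    (K.addDual n u).addDual n w = (K.addDual n w).addDual n u := by
  apply Subtype.ext
  simp only [Char.addDual]
  abel

theorem Char.addDual_neg {Γ : PlumbingGraph V} (K : Γ.Char) (w : V) :
    (K.addDual (-1) w).1 + (2 : ℤ) • Γ.dual w = K.1 := by
  funext u
  simp only [Char.addDual, Pi.add_apply, Pi.smul_apply, smul_eq_mul]
  push_cast
  ring

theorem Char.addDual_neg_zero {Γ : PlumbingGraph V} (K : Γ.Char) (w : V) :
    (K.addDual (-1) w).1 + (2 : ℤ) • Γ.dualZero + (2 : ℤ) • Γ.dual w = K.1 + (2 : ℤ) • Γ.dualZero := by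
  rw [add_right_comm, K.addDual_neg]

/-- The restriction of a characteristic vector of `G` to `G - v`. -/
def Char.restrict {Γ : PlumbingGraph V} (K : Γ.Char) (v : V) : (Γ.delete v).Char :=
  ⟨fun w => K.1 w.1, fun w => by
    have h := K.2 w.1
    simp only [inter, if_true] at h ⊢
    exact h⟩

section

variable [DecidableEq V]

/-- For a characteristic vector `K'` of `G_{+1}(v)` and an integer `m`, the characteristic vector
of `G` that agrees with `K'` off `v` and has value `K'(v) - (2m - 1)` at `v`. So if `K` has the
value `p` at `v`, then `K'` is the vector `(K, p + 2m - 1)`. -/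
def Char.lower {Γ : PlumbingGraph V} {v : V} (K' : (Γ.plusOne v).Char) (m : ℤ) : Γ.Char :=
  ⟨K'.1 - Pi.single v (2 * m - 1), fun w => by
    have h := K'.2 w
    simp only [inter, if_true, plusOne, Pi.sub_apply] at h ⊢
    by_cases hw : w = v
    · subst hw
      rw [Function.update_self] at h
      rw [Pi.single_eq_same]
      unfold Int.ModEq at h ⊢
      omega
    · rw [Function.update_of_ne hw] at h
      rw [Pi.single_eq_of_ne hw, sub_zero]
      exact h⟩

/-- `f(K, I) = (K · I + I²) / 2`, where `I` also denotes the class `∑_{v ∈ I} v`. -/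
def f (Γ : PlumbingGraph V) (K : V → ℤ) (I : Finset V) : ℝ :=
  ((∑ u ∈ I, K u + ∑ u ∈ I, ∑ w ∈ I, Γ.inter u w : ℤ) : ℝ) / 2

/-- `g[K, E] = min_{I ⊆ E} f(K, I)`. -/
def g (Γ : PlumbingGraph V) (K : V → ℤ) (E : Finset V) : ℝ :=
  E.powerset.inf' ⟨∅, Finset.empty_mem_powerset E⟩ (Γ.f K)

/-- `ᵗg[K, E] = (2 - t) g[K, E] + t g[K + 2 v₀ ^*, E]`. -/
def tg (Γ : PlumbingGraph V) (t : ℝ) (K : V → ℤ) (E : Finset V) : ℝ :=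
  (2 - t) * Γ.g K E + t * Γ.g (K + (2 : ℤ) • Γ.dualZero) E

/-- `a_w[K, E] = g[K, E - w] - g[K, E]`. -/
def a (Γ : PlumbingGraph V) (w : V) (K : V → ℤ) (E : Finset V) : ℝ :=
  Γ.g K (E.erase w) - Γ.g K E

/-- `b_w[K, E] = g[K + 2 w ^*, E - w] - g[K, E] + (K · w + w²) / 2`. -/
def b (Γ : PlumbingGraph V) (w : V) (K : V → ℤ) (E : Finset V) : ℝ :=
  Γ.g (K + (2 : ℤ) • Γ.dual w) (E.erase w) - Γ.g K E + ((K w + Γ.inter w w : ℤ) : ℝ) / 2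

/-- `a_w(t) = (2 - t) a_w[K, E] + t a_w[K + 2 v₀ ^*, E]`. -/
def ta (Γ : PlumbingGraph V) (t : ℝ) (w : V) (K : V → ℤ) (E : Finset V) : ℝ :=
  (2 - t) * Γ.a w K E + t * Γ.a w (K + (2 : ℤ) • Γ.dualZero) E

/-- `b_w(t) = (2 - t) b_w[K, E] + t b_w[K + 2 v₀ ^*, E]`. -/
def tb (Γ : PlumbingGraph V) (t : ℝ) (w : V) (K : V → ℤ) (E : Finset V) : ℝ :=
  (2 - t) * Γ.b w K E + t * Γ.b w (K + (2 : ℤ) • Γ.dualZero) E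

/-- The exponent `s_m(t)` of the map onto the complex of `Γ_{+1}(v)`, for a generator `[K, E]`
of `Γ` and the generator `[K', E]` of `Γ_{+1}(v)` with `K' = K` off `v` and
`K'(v) = K(v) + 2m - 1`. -/
def sExp (Γ : PlumbingGraph V) (v : V) (t : ℝ) (m : ℤ) (K K' : V → ℤ) (E : Finset V) : ℝ :=
  (Γ.plusOne v).tg t K' E - Γ.tg t K E + (m : ℝ) * ((m : ℝ) - 1)

theorem a_nonneg (Γ : PlumbingGraph V) (w : V) (K : V → ℤ) (E : Finset V) : 0 ≤ Γ.a w K E :=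
  sub_nonneg.2 (Finset.inf'_mono _ (Finset.powerset_mono.2 (Finset.erase_subset w E)) _)

open Classical in
theorem inter_comm (Γ : PlumbingGraph V) (u w : V) : Γ.inter u w = Γ.inter w u := by
  unfold inter
  by_cases h : u = w
  · subst h; rfl
  · rw [if_neg h, if_neg (Ne.symm h)]
    exact if_congr (Γ.graph.adj_comm _ _) rfl rfl

theorem f_insert (Γ : PlumbingGraph V) (K : V → ℤ) {w : V} {J : Finset V} (hw : w ∉ J) :
    Γ.f K (insert w J) =
      Γ.f (K + (2 : ℤ) • Γ.dual w) J + ((K w + Γ.inter w w : ℤ) : ℝ) / 2 := by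
  unfold f
  rw [← add_div, ← Int.cast_add]
  congr 2
  simp only [Finset.sum_insert hw, Pi.add_apply, Pi.smul_apply, Finset.sum_add_distrib, dual,
    smul_eq_mul, ← Finset.mul_sum]
  have : ∑ u ∈ J, Γ.inter u w = ∑ u ∈ J, Γ.inter w u :=
    Finset.sum_congr rfl fun u _ => Γ.inter_comm u w
  rw [this]
  ring

theorem b_nonneg (Γ : PlumbingGraph V) {w : V} (K : V → ℤ) {E : Finset V} (hw : w ∈ E) :
    0 ≤ Γ.b w K E := by
  obtain ⟨J, hJ, hJ'⟩ := Finset.exists_mem_eq_inf' (s := (E.erase w).powerset)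
    ⟨∅, Finset.empty_mem_powerset _⟩ (Γ.f (K + (2 : ℤ) • Γ.dual w))
  have hJE := Finset.mem_powerset.1 hJ
  have hwJ : w ∉ J := fun h => (Finset.mem_erase.1 (hJE h)).1 rfl
  have h1 : Γ.g K E ≤ Γ.f K (insert w J) := by
    refine Finset.inf'_le _ (Finset.mem_powerset.2 ?_)
    exact Finset.insert_subset hw (hJE.trans (Finset.erase_subset _ _))
  rw [f_insert Γ K hwJ] at h1
  have h2 : Γ.g (K + (2 : ℤ) • Γ.dual w) (E.erase w) = Γ.f (K + (2 : ℤ) • Γ.dual w) J := hJ'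
  unfold b
  rw [h2]
  linarith

theorem ta_nonneg (Γ : PlumbingGraph V) (t : Set.Icc (0 : ℝ) 2) (w : V) (K : V → ℤ)
    (E : Finset V) : 0 ≤ Γ.ta t w K E :=
  add_nonneg (mul_nonneg (sub_nonneg.2 t.2.2) (Γ.a_nonneg _ _ _))
    (mul_nonneg t.2.1 (Γ.a_nonneg _ _ _))

theorem tb_nonneg (Γ : PlumbingGraph V) (t : Set.Icc (0 : ℝ) 2) {w : V} (K : V → ℤ)
    {E : Finset V} (hw : w ∈ E) : 0 ≤ Γ.tb t w K E :=
  add_nonneg (mul_nonneg (sub_nonneg.2 t.2.2) (Γ.b_nonneg _ hw))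
    (mul_nonneg t.2.1 (Γ.b_nonneg _ hw))

theorem ta_insert (Γ : PlumbingGraph V) (t : ℝ) {w : V} (K : V → ℤ) {E : Finset V} (hw : w ∉ E) :
    Γ.ta t w K (insert w E) = Γ.tg t K E - Γ.tg t K (insert w E) := by
  simp only [ta, a, tg, Finset.erase_insert hw]
  ring

theorem tb_insert (Γ : PlumbingGraph V) (t : ℝ) {w : V} (K : Γ.Char) {E : Finset V} (hw : w ∉ E) :
    Γ.tb t w (K.addDual (-1) w).1 (insert w E) =
      Γ.tg t K.1 E - Γ.tg t (K.addDual (-1) w).1 (insert w E) +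
        ((K.1 w : ℝ) + t * (Γ.dualZero w : ℝ) - (Γ.inter w w : ℝ)) := by
  simp only [tb, b, tg, Finset.erase_insert hw, K.addDual_neg, K.addDual_neg_zero]
  simp only [Char.addDual, dual, Pi.add_apply, Pi.smul_apply, smul_eq_mul]
  push_cast
  ring

/-- The generators `[K, E]`: a characteristic vector and a set of framed vertices. -/
abbrev Gen (Γ : PlumbingGraph V) : Type u := Γ.Char × Finset V

/-- The summands of `∂_t ∂_t x` that come from removing first `w`, then `u`. -/
def bdryTerm (Γ : PlumbingGraph V) (t : Set.Icc (0 : ℝ) 2) (x : Γ.Gen → LongPowerSeries)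
    (K : Γ.Char) (E : Finset V) (u w : V) : LongPowerSeries :=
  qPow (Γ.ta t u K.1 (insert u E)) *
    (qPow (Γ.ta t w K.1 (insert w (insert u E))) * x (K, insert w (insert u E)) +
      qPow (Γ.tb t w (K.addDual (-1) w).1 (insert w (insert u E))) *
        x (K.addDual (-1) w, insert w (insert u E))) +
  qPow (Γ.tb t u (K.addDual (-1) u).1 (insert u E)) *
    (qPow (Γ.ta t w (K.addDual (-1) u).1 (insert w (insert u E))) *
        x (K.addDual (-1) u, insert w (insert u E)) +
      qPow (Γ.tb t w ((K.addDual (-1) u).addDual (-1) w).1 (insert w (insert u E))) *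
        x ((K.addDual (-1) u).addDual (-1) w, insert w (insert u E)))

theorem bdryTerm_swap (Γ : PlumbingGraph V) (t : Set.Icc (0 : ℝ) 2) (x : Γ.Gen → LongPowerSeries)
    (K : Γ.Char) (E : Finset V) {u w : V} (hu : u ∉ E) (hw : w ∉ E) (huw : u ≠ w) :
    Γ.bdryTerm t x K E u w = Γ.bdryTerm t x K E w u := by
  have hu' : u ∉ insert w E := by simp [hu, huw]
  have hw' : w ∉ insert u E := by simp [hw, huw.symm]
  have hE : insert w (insert u E) = insert u (insert w E) := Finset.insert_comm _ _ _
  have a0 := fun v K E => Γ.ta_nonneg t v K E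
  have b0 := fun (v : V) (K : V → ℤ) (E : Finset V) =>
    Γ.tb_nonneg t K (Finset.mem_insert_self v E)
  have key : ∀ L : LongPowerSeries, ∀ p p' r r' : ℝ, 0 ≤ p → 0 ≤ p' → 0 ≤ r → 0 ≤ r' →
      p + p' = r + r' → qPow p * (qPow p' * L) = qPow r * (qPow r' * L) := by
    intro L p p' r r' h1 h2 h3 h4 h
    rw [← mul_assoc, ← mul_assoc, qPow_mul h1 h2, qPow_mul h3 h4, h]
  unfold bdryTerm
  simp only [mul_add]
  rw [key (x (K, insert w (insert u E))) _ _ (Γ.ta t w K.1 (insert w E))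
      (Γ.ta t u K.1 (insert u (insert w E))) (a0 _ _ _) (a0 _ _ _) (a0 _ _ _) (a0 _ _ _) ?_,
    key (x (K.addDual (-1) w, insert w (insert u E))) _ _
      (Γ.tb t w (K.addDual (-1) w).1 (insert w E))
      (Γ.ta t u (K.addDual (-1) w).1 (insert u (insert w E)))
      (a0 _ _ _) (b0 _ _ _) (b0 _ _ _) (a0 _ _ _) ?_,
    key (x (K.addDual (-1) u, insert w (insert u E))) _ _
      (Γ.ta t w K.1 (insert w E))
      (Γ.tb t u (K.addDual (-1) u).1 (insert u (insert w E)))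
      (b0 _ _ _) (a0 _ _ _) (a0 _ _ _) (b0 _ _ _) ?_,
    key (x ((K.addDual (-1) u).addDual (-1) w, insert w (insert u E))) _ _
      (Γ.tb t w (K.addDual (-1) w).1 (insert w E))
      (Γ.tb t u ((K.addDual (-1) w).addDual (-1) u).1 (insert u (insert w E)))
      (b0 _ _ _) (b0 _ _ _) (b0 _ _ _) (b0 _ _ _) ?_,
    hE, K.addDual_comm (-1) u w]
  · ring
  · rw [Γ.tb_insert t _ hu, Γ.tb_insert t _ hw', Γ.tb_insert t _ hw, Γ.tb_insert t _ hu', hE,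
      K.addDual_comm (-1) u w]
    simp only [Char.addDual, dual, Pi.add_apply, Pi.smul_apply, smul_eq_mul, Γ.inter_comm w u]
    push_cast
    ring
  · rw [Γ.tb_insert t _ hu, Γ.ta_insert t _ hw', Γ.ta_insert t _ hw, Γ.tb_insert t _ hu', hE]
    ring
  · rw [Γ.ta_insert t _ hu, Γ.tb_insert t _ hw', Γ.tb_insert t _ hw, Γ.ta_insert t _ hu', hE]
    ring
  · rw [Γ.ta_insert t _ hu, Γ.ta_insert t _ hw', Γ.ta_insert t _ hw, Γ.ta_insert t _ hu', hE]
    ring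

end

variable [Fintype V] [DecidableEq V]

/-- The differential `∂_t` on formal sums `x = ∑ x[K, E] [K, E]`, the (possibly infinite) linear
extension of
`∂_t [K, E] = ∑_{w ∈ E} (q ^ a_w(t) [K, E - w] + q ^ b_w(t) [K + 2 w ^*, E - w])`.
The coefficient of `∂_t x` at `[K, E]` collects, over `w ∉ E`, the contributions of
`[K, E ∪ w]` and of `[K - 2 w ^*, E ∪ w]`. -/
def bdry (Γ : PlumbingGraph V) (t : Set.Icc (0 : ℝ) 2) :
    (Γ.Gen → LongPowerSeries) →ₗ[LongPowerSeries] (Γ.Gen → LongPowerSeries) where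
  toFun x := fun y => ∑ w ∈ y.2ᶜ,
    (qPow (Γ.ta t w y.1.1 (insert w y.2)) * x (y.1, insert w y.2) +
      qPow (Γ.tb t w (y.1.addDual (-1) w).1 (insert w y.2)) *
        x (y.1.addDual (-1) w, insert w y.2))
  map_add' x x' := by
    funext y
    simp only [Pi.add_apply, ← Finset.sum_add_distrib]
    exact Finset.sum_congr rfl fun w _ => by ring
  map_smul' r x := by
    funext y
    simp only [Pi.smul_apply, smul_eq_mul, RingHom.id_apply, Finset.mul_sum]
    exact Finset.sum_congr rfl fun w _ => by ring

/-- The chains of lattice degree `p`: formal sums of generators `[K, E]` with `|E| = p`. -/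
def chains (Γ : PlumbingGraph V) (p : ℤ) :
    Submodule LongPowerSeries (Γ.Gen → LongPowerSeries) where
  carrier := {x | ∀ y : Γ.Gen, (y.2.card : ℤ) ≠ p → x y = 0}
  add_mem' hx hx' y hy := by rw [Pi.add_apply, hx y hy, hx' y hy, add_zero]
  zero_mem' _ _ := rfl
  smul_mem' r x hx y hy := by rw [Pi.smul_apply, hx y hy, smul_zero]

theorem bdry_mem (Γ : PlumbingGraph V) (t : Set.Icc (0 : ℝ) 2) (p p' : ℤ) (h : p' + 1 = p)
    (x : Γ.Gen → LongPowerSeries) (hx : x ∈ Γ.chains p) : Γ.bdry t x ∈ Γ.chains p' := by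
  intro y hy
  refine Finset.sum_eq_zero fun w hw => ?_
  have hc : ((insert w y.2).card : ℤ) ≠ p := by
    rw [Finset.card_insert_of_notMem (Finset.mem_compl.1 hw)]
    push_cast
    omega
  rw [hx (_, _) hc, hx (_, _) hc, mul_zero, mul_zero, add_zero]

theorem bdry_bdry (Γ : PlumbingGraph V) (t : Set.Icc (0 : ℝ) 2) (x : Γ.Gen → LongPowerSeries) :
    Γ.bdry t (Γ.bdry t x) = 0 := by
  funext y
  obtain ⟨K, E⟩ := y
  have h1 : Γ.bdry t (Γ.bdry t x) (K, E) =
      ∑ u ∈ Eᶜ, ∑ w ∈ (insert u E)ᶜ, Γ.bdryTerm t x K E u w := by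
    refine Finset.sum_congr rfl fun u _ => ?_
    simp only [bdry, LinearMap.coe_mk, AddHom.coe_mk, Finset.mul_sum, ← Finset.sum_add_distrib]
    exact Finset.sum_congr rfl fun w _ => rfl
  rw [h1, Finset.sum_sigma']
  refine Finset.sum_involution (fun z _ => ⟨z.2, z.1⟩) ?_ ?_ ?_ ?_
  · rintro ⟨u, w⟩ hz
    simp only [Finset.mem_sigma, Finset.mem_compl, Finset.mem_insert, not_or] at hz
    rw [Γ.bdryTerm_swap t x K E hz.1 hz.2.2 (Ne.symm hz.2.1)]
    exact LongPowerSeries.add_self _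
  · rintro ⟨u, w⟩ hz _ h
    simp only [Finset.mem_sigma, Finset.mem_compl, Finset.mem_insert, not_or] at hz
    exact hz.2.1 (congrArg Sigma.fst h)
  · rintro ⟨u, w⟩ hz
    simp only [Finset.mem_sigma, Finset.mem_compl, Finset.mem_insert, not_or] at hz ⊢
    exact ⟨hz.2.2, Ne.symm hz.2.1, hz.1⟩
  · rintro ⟨u, w⟩ _
    rfl

/-- The deformed lattice complex `ℂ𝔽_t(Γ)`: in degree `p`, the direct product of copies of `ℛ`
over the generators `[K, E]` with `|E| = p`, with the differential `∂_t`. -/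
def latticeComplex (Γ : PlumbingGraph V) (t : Set.Icc (0 : ℝ) 2) :
    ChainComplex (ModuleCat.{u} LongPowerSeries) ℤ where
  X p := ModuleCat.of LongPowerSeries (Γ.chains p)
  d p p' := if h : p' + 1 = p then
      ModuleCat.ofHom ((Γ.bdry t).restrict (Γ.bdry_mem t p p' h)) else 0
  shape p p' h := dif_neg h
  d_comp_d' p p' p'' h h' := by
    rw [dif_pos (show p' + 1 = p from h), dif_pos (show p'' + 1 = p' from h'),
      ← ModuleCat.ofHom_comp]
    refine ModuleCat.hom_ext (LinearMap.ext fun x => Subtype.ext ?_)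
    exact Γ.bdry_bdry t x.1

/-- The coefficient of the generator `[K, E]` in a chain. -/
def coef {Γ : PlumbingGraph V} {t : Set.Icc (0 : ℝ) 2} {p : ℤ} (x : (Γ.latticeComplex t).X p)
    (K : Γ.Char) (E : Finset V) : LongPowerSeries :=
  Subtype.val (p := fun y => y ∈ Γ.chains p) x (K, E)

/-- The lattice group `tℍ𝔽𝕂_p(Γ)`. -/
abbrev tHFK (Γ : PlumbingGraph V) (t : Set.Icc (0 : ℝ) 2) (p : ℤ) : ModuleCat.{u} LongPowerSeries :=
  (Γ.latticeComplex t).homology p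

/-- `A = A_t : ℂ𝔽_t(Γ - v) → ℂ𝔽_t(Γ)` is the map `[K, E] ↦ ∑_p [K, p, E]`: a generator of `Γ`
with `v ∉ E` receives the coefficient of its restriction to `Γ - v`, and one with `v ∈ E`
receives zero. -/
def IsMapA (Γ : PlumbingGraph V) (v : V) (t : Set.Icc (0 : ℝ) 2)
    (A : (Γ.delete v).latticeComplex t ⟶ Γ.latticeComplex t) : Prop :=
  ∀ (p : ℤ) (x : ((Γ.delete v).latticeComplex t).X p) (K : Γ.Char) (E : Finset V),
    coef (A.f p x) K E = if v ∈ E then 0 else coef x (K.restrict v) (E.subtype (· ≠ v))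

/-- `B = B_t : ℂ𝔽_t(Γ) → ℂ𝔽_t(Γ_{+1}(v))` is the map
`[K, p, E] ↦ ∑_{m ∈ ℤ} q ^ s_m(t) [K, p + 2m - 1, E]`: all exponents are nonnegative, and the
coefficient of `B x` at `[K', E]` is the sum over `m` of the contributions of the generators
`[K, E]` with `K' = K` off `v` and `K'(v) = K(v) + 2m - 1`. That sum of long power series is
locally finite: each power `q ^ α` occurs in only finitely many of its terms. -/
def IsMapB (Γ : PlumbingGraph V) (v : V) (t : Set.Icc (0 : ℝ) 2)
    (B : Γ.latticeComplex t ⟶ (Γ.plusOne v).latticeComplex t) : Prop :=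
  (∀ (K' : (Γ.plusOne v).Char) (m : ℤ) (E : Finset V),
    0 ≤ Γ.sExp v t m (K'.lower m).1 K'.1 E) ∧
  ∀ (p : ℤ) (x : (Γ.latticeComplex t).X p) (K' : (Γ.plusOne v).Char) (E : Finset V) (α : NNReal),
    (Function.support fun m : ℤ =>
      (qPow (Γ.sExp v t m (K'.lower m).1 K'.1 E) * coef x (K'.lower m) E).coeff α).Finite ∧
    (coef (B.f p x) K' E).coeff α = ∑ᶠ m : ℤ,
      (qPow (Γ.sExp v t m (K'.lower m).1 K'.1 E) * coef x (K'.lower m) E).coeff α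

end PlumbingGraph

end

/-!
The exponents `s_m(t)` are differences of values of `ᵗg` plus `m (m - 1)`, since raising the framing
of `v` by one has the same effect on `g` as raising `K(v)` by one (`PlumbingGraph.plusOne_tg`). As a
function of `n`, `ᵗg[K + 2n v ^♯, E]` (with `v ^♯` equal to `1` at `v` and `0` elsewhere) is
nondecreasing with increments at most `2`. Hence `s_m(t) ≥ |m| (|m| - 1)`, which gives `s_m(t) ≥ 0`
and the local finiteness of the sums defining `B_t`. That `A_t` and `B_t` are chain maps is a
comparison of exponents; for `B_t` and the vertex `v` itself, the index `m` is shifted by one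
(`PlumbingGraph.Char.lower_addDual`).

Exactness is checked line by line: fix `E` and the restriction of `K` to `G - v`, and let the value
`K(v)` vary. On such a line `B_t` becomes an operator
`x ↦ (∑_m q ^ e(n, m) x_{n - m})_n` on two-sided sequences (`LongPowerSeries.thetaOp`).

* If `v ∉ E`, then `e(n, m) = m (m - 1)`. The terms for `m` and `1 - m` cancel on constant
  sequences, which gives `B_t A_t = 0`. Up to terms of order at least `1` the operator is `x_n + x_{n - 1}`,
  which is surjective with kernel the constant sequences, and the same follows for the operator.
* If `v ∈ E`, then `n ↦ ᵗg[K + 2n v ^♯, E]` is concave with slopes from `2` down to `0`. If the slope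
  passes `1` at `k`, then up to terms of order at least `1` the operator involves only `x_n` and
  `x_{n - 1}` for `n > k`, only `x_n` and `x_{n + 1}` for `n < k`, and only `x_k` for `n = k`. Such a
  system is solved by recursion in both directions from `k`, so the operator is bijective.

In both cases the passage from the leading part to the whole operator is by successive approximation
(`LongPowerSeries.surjective_of_approx` and `LongPowerSeries.eq_zero_of_approx`). So the kernel of
`B_t` consists of the sums that vanish for `v ∈ E` and do not depend on `K(v)` for `v ∉ E`, which is
the image of `A_t`. The long exact sequence is that of the short exact sequence of complexes.
-/

noncomputable section

namespace LongPowerSeries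

/-! ### Locally finite sums of long power series -/

/-- The ideal of long power series all of whose exponents are at least `c`. -/
def ordIdeal (c : ℕ) : Ideal LongPowerSeries where
  carrier := {x | ∀ α : NNReal, α < c → x.coeff α = 0}
  add_mem' hx hy α hα := by rw [HahnSeries.coeff_add, hx α hα, hy α hα, add_zero]
  zero_mem' _ _ := rfl
  smul_mem' r x hx α hα := by
    rw [smul_eq_mul, HahnSeries.coeff_mul]
    refine Finset.sum_eq_zero fun ij hij => ?_
    have h := (Finset.mem_antidiagonal.1 hij).2.2
    rw [hx ij.2 (lt_of_le_of_lt (h ▸ le_add_self) hα), mul_zero]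

theorem mem_ordIdeal_zero (x : LongPowerSeries) : x ∈ ordIdeal 0 :=
  fun α hα => absurd hα (by simp)

theorem eq_zero_of_forall_mem_ordIdeal {x : LongPowerSeries} (h : ∀ c, x ∈ ordIdeal c) :
    x = 0 := by
  ext α
  obtain ⟨c, hc⟩ := exists_nat_gt α
  exact h c α hc

theorem coeff_qPow_mul_eq_zero {e : ℝ} {c : ℕ} {x : LongPowerSeries} (hx : x ∈ ordIdeal c)
    {α : NNReal} (hα : (α : ℝ) < e + c) : (qPow e * x).coeff α = 0 := by
  rw [qPow, HahnSeries.coeff_mul]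
  refine Finset.sum_eq_zero fun ij hij => ?_
  obtain ⟨h1, -, h⟩ := Finset.mem_antidiagonal.1 hij
  have h1' : ij.1 = e.toNNReal := by
    by_contra hne
    exact h1 (HahnSeries.coeff_single_of_ne hne)
  rw [hx ij.2 ?_, mul_zero]
  have h2 : (ij.1 : ℝ) + ij.2 = α := by rw [← h]; push_cast; rfl
  have h3 : e ≤ (ij.1 : ℝ) := by rw [h1']; exact Real.le_coe_toNNReal e
  have h4 : (ij.2 : ℝ) < c := by linarith
  exact_mod_cast h4

theorem qPow_zero : qPow 0 = 1 := by
  rw [qPow, Real.toNNReal_zero]; rfl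

section lsum

variable {ι κ : Type*}

/-- A family of long power series is locally finite if, for every bound `c`, only finitely many
of its members have a nonzero coefficient at some exponent `≤ c`. -/
def LocFinite (y : ι → LongPowerSeries) : Prop :=
  ∀ c : NNReal, {i | ∃ α ≤ c, (y i).coeff α ≠ 0}.Finite

theorem LocFinite.support_finite {y : ι → LongPowerSeries} (hy : LocFinite y) (α : NNReal) :
    (Function.support fun i => (y i).coeff α).Finite :=
  (hy α).subset fun _ hi => ⟨α, le_rfl, hi⟩

theorem LocFinite.isPWO {y : ι → LongPowerSeries} (hy : LocFinite y) :
    (⋃ i, (y i).support).IsPWO := by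
  -- A sequence of exponents either returns above its first term `f 0`, or stays below `f 0`,
  -- where only finitely many members of the family matter.
  intro f
  by_cases h : ∃ n, 0 < n ∧ f 0 ≤ f n
  · obtain ⟨n, hn, hfn⟩ := h
    exact ⟨0, n, hn, hfn⟩
  · push Not at h
    have hle : ∀ n, f n ≤ f 0 := fun n => by
      rcases Nat.eq_zero_or_pos n with rfl | hn
      · exact le_rfl
      · exact (h n hn).le
    have hP : (⋃ i ∈ (hy (f 0).1).toFinset, (y i).support).IsPWO :=
      (Finset.isPWO_bUnion _).2 fun i _ => (y i).isPWO_support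
    have hf : ∀ n, (f n).1 ∈ ⋃ i ∈ (hy (f 0).1).toFinset, (y i).support := fun n => by
      obtain ⟨i, hi⟩ := Set.mem_iUnion.1 (f n).2
      exact Set.mem_biUnion (by simpa using ⟨(f n).1, hle n, hi⟩) hi
    exact hP fun n => ⟨(f n).1, hf n⟩

/-- A locally finite family as a summable family of Hahn series. -/
def LocFinite.family {y : ι → LongPowerSeries} (hy : LocFinite y) :
    HahnSeries.SummableFamily NNReal (ZMod 2) ι :=
  ⟨y, hy.isPWO, hy.support_finite⟩

open Classical in
/-- The sum of a locally finite family of long power series; it is `0` for other families. -/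
def lsum (y : ι → LongPowerSeries) : LongPowerSeries :=
  if h : LocFinite y then h.family.hsum else 0

theorem LocFinite.coeff_lsum {y : ι → LongPowerSeries} (hy : LocFinite y) (α : NNReal) :
    (lsum y).coeff α = ∑ᶠ i, (y i).coeff α := by
  rw [lsum, dif_pos hy]; rfl

theorem LocFinite.add {y z : ι → LongPowerSeries} (hy : LocFinite y) (hz : LocFinite z) :
    LocFinite fun i => y i + z i := by
  refine fun c => ((hy c).union (hz c)).subset ?_
  rintro i ⟨α, hα, h⟩
  by_contra hn
  simp only [Set.mem_union, Set.mem_ofPred_eq, not_or, not_exists, not_and, not_not] at hn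
  exact h (by rw [HahnSeries.coeff_add, hn.1 α hα, hn.2 α hα, add_zero])

theorem LocFinite.mul_left {y : ι → LongPowerSeries} (r : LongPowerSeries) (hy : LocFinite y) :
    LocFinite fun i => r * y i := by
  refine fun c => (hy c).subset ?_
  rintro i ⟨α, hα, h⟩
  rw [HahnSeries.coeff_mul] at h
  obtain ⟨ij, hij, hne⟩ := Finset.exists_ne_zero_of_sum_ne_zero h
  refine ⟨ij.2, le_trans ?_ hα, right_ne_zero_of_mul hne⟩
  rw [← (Finset.mem_antidiagonal.1 hij).2.2]
  exact le_add_self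

theorem LocFinite.comp_equiv {y : ι → LongPowerSeries} (hy : LocFinite y) (e : κ ≃ ι) :
    LocFinite fun k => y (e k) :=
  fun c => Set.Finite.preimage (f := e) e.injective.injOn (hy c)

theorem lsum_add {y z : ι → LongPowerSeries} (hy : LocFinite y) (hz : LocFinite z) :
    lsum (fun i => y i + z i) = lsum y + lsum z := by
  ext α
  rw [(hy.add hz).coeff_lsum, HahnSeries.coeff_add, hy.coeff_lsum, hz.coeff_lsum,
    ← finsum_add_distrib (hy.support_finite α) (hz.support_finite α)]
  rfl

theorem lsum_mul_left {y : ι → LongPowerSeries} (r : LongPowerSeries) (hy : LocFinite y) :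
    lsum (fun i => r * y i) = r * lsum y := by
  have h : (hy.mul_left r).family = r • hy.family := by
    ext1 i
    rw [HahnSeries.SummableFamily.smul_apply]
    rfl
  rw [lsum, lsum, dif_pos hy, dif_pos (hy.mul_left r), h, HahnSeries.SummableFamily.hsum_smul]

theorem lsum_comp_equiv {y : ι → LongPowerSeries} (hy : LocFinite y) (e : κ ≃ ι) :
    lsum (fun k => y (e k)) = lsum y := by
  ext α
  rw [(hy.comp_equiv e).coeff_lsum, hy.coeff_lsum]
  exact finsum_comp_equiv e (f := fun i => (y i).coeff α)

theorem LocFinite.coeff_lsum_of_subset {y : ι → LongPowerSeries} (hy : LocFinite y)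
    {α : NNReal} {s : Finset ι} (hs : ∀ i ∉ s, (y i).coeff α = 0) :
    (lsum y).coeff α = (∑ i ∈ s, y i).coeff α := by
  rw [hy.coeff_lsum, HahnSeries.coeff_sum]
  refine finsum_eq_sum_of_support_subset _ fun i hi => ?_
  by_contra h
  exact hi (hs i h)

end lsum

/-! ### Successive approximation -/

section approximation

variable {ι : Type*}

/-- The families of long power series all of whose exponents are at least `c`. -/
def ordSub (ι : Type*) (c : ℕ) : Submodule LongPowerSeries (ι → LongPowerSeries) :=
  Submodule.pi Set.univ fun _ => ordIdeal c

theorem mem_ordSub {c : ℕ} {x : ι → LongPowerSeries} :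
    x ∈ ordSub ι c ↔ ∀ i, x i ∈ ordIdeal c := by
  simp [ordSub]

theorem eq_zero_of_forall_mem_ordSub {x : ι → LongPowerSeries} (h : ∀ c, x ∈ ordSub ι c) :
    x = 0 :=
  funext fun i => eq_zero_of_forall_mem_ordIdeal fun c => mem_ordSub.1 (h c) i

/-- A series of families whose `k`-th term has exponents at least `k` converges. -/
theorem exists_forall_sub_sum_mem_ordSub (x : ℕ → ι → LongPowerSeries)
    (hx : ∀ k, x k ∈ ordSub ι k) :
    ∃ z : ι → LongPowerSeries, ∀ c, z - ∑ k ∈ Finset.range c, x k ∈ ordSub ι c := by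
  have hfin : ∀ i, LocFinite fun k => x k i := by
    intro i c
    obtain ⟨n, hn⟩ := exists_nat_gt c
    refine (Set.finite_lt_nat n).subset ?_
    rintro k ⟨α, hα, h⟩
    by_contra hk
    refine h (mem_ordSub.1 (hx k) i α (lt_of_le_of_lt hα (hn.trans_le ?_)))
    exact_mod_cast not_lt.1 hk
  refine ⟨fun i => lsum fun k => x k i, fun c => mem_ordSub.2 fun i α hα => ?_⟩
  rw [Pi.sub_apply, Finset.sum_apply, HahnSeries.coeff_sub,
    (hfin i).coeff_lsum_of_subset (s := Finset.range c), sub_self]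
  intro k hk
  refine mem_ordSub.1 (hx k) i α (hα.trans_le ?_)
  exact_mod_cast not_lt.1 (Finset.mem_range.not.1 hk)

variable {B P : (ι → LongPowerSeries) →ₗ[LongPowerSeries] (ι → LongPowerSeries)}

/-- If `B` agrees with `P` up to terms of higher order, and `P x = y` can be solved without
lowering the order, then `B` is surjective: solve with `P` and correct the error repeatedly. -/
theorem surjective_of_approx (hB : ∀ c, ∀ x ∈ ordSub ι c, B x ∈ ordSub ι c)
    (hBP : ∀ c, ∀ x ∈ ordSub ι c, B x - P x ∈ ordSub ι (c + 1))
    (hP : ∀ y, ∃ x, P x = y ∧ ∀ c, y ∈ ordSub ι c → x ∈ ordSub ι c) :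
    Function.Surjective B := by
  intro y
  choose S hPS hS using hP
  -- `r k` is the error left after `k` corrections.
  let r : ℕ → ι → LongPowerSeries := fun k => Nat.rec y (fun _ z => z - B (S z)) k
  have hrs : ∀ k, r (k + 1) = r k - B (S (r k)) := fun k => rfl
  have hr : ∀ k, r k ∈ ordSub ι k := by
    intro k
    induction k with
    | zero => exact mem_ordSub.2 fun i => mem_ordIdeal_zero _
    | succ k ih =>
      have h := Submodule.neg_mem _ (hBP k _ (hS _ k ih))
      rwa [hPS, neg_sub] at h
  obtain ⟨z, hz⟩ := exists_forall_sub_sum_mem_ordSub (fun k => S (r k)) fun k => hS _ k (hr k)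
  have hsum : ∀ c, B (∑ k ∈ Finset.range c, S (r k)) = y - r c := by
    intro c
    induction c with
    | zero => simp [r]
    | succ c ih => rw [Finset.sum_range_succ, map_add, ih, hrs]; abel
  refine ⟨z, sub_eq_zero.1 (eq_zero_of_forall_mem_ordSub fun c => ?_)⟩
  have h := Submodule.sub_mem _ (hB c _ (hz c)) (hr c)
  rw [map_sub, hsum] at h
  convert h using 1
  abel

/-- If `B` agrees with `P` up to terms of higher order, and `P` does not raise the order of the
vectors satisfying `Q`, then `B` has no kernel among these vectors. -/
theorem eq_zero_of_approx (Q : (ι → LongPowerSeries) → Prop)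
    (hBP : ∀ c, ∀ x ∈ ordSub ι c, B x - P x ∈ ordSub ι (c + 1))
    (hP : ∀ x, Q x → ∀ c, P x ∈ ordSub ι c → x ∈ ordSub ι c)
    {x : ι → LongPowerSeries} (hQ : Q x) (hx : B x = 0) : x = 0 := by
  refine eq_zero_of_forall_mem_ordSub fun c => ?_
  induction c with
  | zero => exact mem_ordSub.2 fun i => mem_ordIdeal_zero _
  | succ c ih =>
    have h := Submodule.neg_mem _ (hBP c x ih)
    rw [hx, zero_sub, neg_neg] at h
    exact hP x hQ _ h

end approximation

/-! ### Sums of theta type -/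

/-- Exponents `e m` that grow at least as fast as `|m| (|m| - 1)`. -/
def IsThetaExp (e : ℤ → ℝ) : Prop := ∀ m : ℤ, ((|m| * (|m| - 1) : ℤ) : ℝ) ≤ e m

theorem IsThetaExp.nonneg {e : ℤ → ℝ} (he : IsThetaExp e) (m : ℤ) : 0 ≤ e m := by
  refine le_trans ?_ (he m)
  rcases eq_or_ne m 0 with rfl | hm
  · simp
  · have h := Int.one_le_abs hm
    exact_mod_cast mul_nonneg (by lia) (by lia)

theorem IsThetaExp.two_le {e : ℤ → ℝ} (he : IsThetaExp e) {m : ℤ} (hm : 2 ≤ |m|) : 2 ≤ e m := by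
  refine le_trans ?_ (he m)
  exact_mod_cast (show (2 : ℤ) ≤ |m| * (|m| - 1) by nlinarith)

theorem IsThetaExp.locFinite {e : ℤ → ℝ} (he : IsThetaExp e) (x : ℤ → LongPowerSeries) :
    LocFinite fun m => qPow (e m) * x m := by
  intro c
  obtain ⟨N, hN⟩ := exists_nat_gt c
  refine (Set.finite_Icc (-(N + 1 : ℤ)) (N + 1)).subset ?_
  rintro m ⟨α, hα, h⟩
  rw [Set.mem_Icc, ← abs_le]
  by_contra hm
  refine h (coeff_qPow_mul_eq_zero (mem_ordIdeal_zero _) ?_)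
  have h1 : (N : ℤ) ≤ |m| * (|m| - 1) := by
    have : (N : ℤ) + 2 ≤ |m| := by lia
    nlinarith
  have h2 : (N : ℝ) ≤ e m := le_trans (by exact_mod_cast h1) (he m)
  have h3 : (α : ℝ) < N := by exact_mod_cast hα.trans_lt hN
  rw [Nat.cast_zero, add_zero]
  exact h3.trans_le h2

/-- The functional `x ↦ ∑_m q ^ e(m) x_m` on two-sided sequences. -/
def thetaSum (e : ℤ → ℝ) (he : IsThetaExp e) :
    (ℤ → LongPowerSeries) →ₗ[LongPowerSeries] LongPowerSeries where
  toFun x := lsum fun m => qPow (e m) * x m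
  map_add' x y := by
    rw [← lsum_add (he.locFinite x) (he.locFinite y)]
    simp only [Pi.add_apply, mul_add]
  map_smul' r x := by
    rw [RingHom.id_apply, smul_eq_mul, ← lsum_mul_left r (he.locFinite x)]
    simp only [Pi.smul_apply, smul_eq_mul, mul_left_comm]

theorem thetaSum_apply {e : ℤ → ℝ} (he : IsThetaExp e) (x : ℤ → LongPowerSeries) :
    thetaSum e he x = lsum fun m => qPow (e m) * x m := rfl

theorem thetaSum_congr {e e' : ℤ → ℝ} (he : IsThetaExp e) (he' : IsThetaExp e')
    (h : ∀ m, e m = e' m) {x x' : ℤ → LongPowerSeries} (hx : ∀ m, x m = x' m) :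
    thetaSum e he x = thetaSum e' he' x' := by
  obtain rfl : e = e' := funext h
  obtain rfl : x = x' := funext hx
  rfl

/-- If all exponents outside `s` are at least `d`, the terms outside `s` raise the order
by `d`. -/
theorem thetaSum_sub_sum_mem {e : ℤ → ℝ} (he : IsThetaExp e) {x : ℤ → LongPowerSeries}
    {c d : ℕ} (hx : ∀ m, x m ∈ ordIdeal c) (s : Finset ℤ) (hs : ∀ m ∉ s, (d : ℝ) ≤ e m) :
    thetaSum e he x - ∑ m ∈ s, qPow (e m) * x m ∈ ordIdeal (c + d) := by
  intro α hα
  rw [HahnSeries.coeff_sub, thetaSum_apply, (he.locFinite x).coeff_lsum_of_subset (s := s),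
    sub_self]
  intro m hm
  refine coeff_qPow_mul_eq_zero (hx m) ?_
  have h1 : (α : ℝ) < c + d := by exact_mod_cast hα
  linarith [hs m hm]

/-- For the exponents `m (m - 1)`, the terms for `m` and `1 - m` agree, and hence cancel
on constant sequences. -/
theorem thetaSum_const {e : ℤ → ℝ} (he : IsThetaExp e) (h : ∀ m : ℤ, e (1 - m) = e m)
    (r : LongPowerSeries) : thetaSum e he (fun _ => r) = 0 := by
  ext α
  rw [thetaSum_apply, (he.locFinite _).coeff_lsum, HahnSeries.coeff_zero,
    finsum_eq_sum _ ((he.locFinite fun _ => r).support_finite α)]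
  refine Finset.sum_involution (fun m _ => 1 - m) ?_ ?_ ?_ ?_
  · intro m _
    rw [h]
    exact CharTwo.add_self_eq_zero _
  · intro m _ _ hm
    lia
  · intro m hm
    simpa [h] using hm
  · intro m _
    ring

variable {e : ℤ → ℤ → ℝ}

/-- The operator `x ↦ (∑_m q ^ e(n, m) x_{n - m})_n` on two-sided sequences. -/
def thetaOp (e : ℤ → ℤ → ℝ) (he : ∀ n, IsThetaExp (e n)) :
    (ℤ → LongPowerSeries) →ₗ[LongPowerSeries] (ℤ → LongPowerSeries) :=
  LinearMap.pi fun n => (thetaSum (e n) (he n)).comp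
    (LinearMap.funLeft LongPowerSeries LongPowerSeries fun m => n - m)

theorem thetaOp_apply (he : ∀ n, IsThetaExp (e n)) (x : ℤ → LongPowerSeries) (n : ℤ) :
    thetaOp e he x n = thetaSum (e n) (he n) fun m => x (n - m) := rfl

/-- The part of `thetaOp` given by the terms with `m ∈ S n`. -/
def truncOp (e : ℤ → ℤ → ℝ) (S : ℤ → Finset ℤ) :
    (ℤ → LongPowerSeries) →ₗ[LongPowerSeries] (ℤ → LongPowerSeries) :=
  LinearMap.pi fun n => ∑ m ∈ S n, qPow (e n m) •
    (LinearMap.proj (n - m) : (ℤ → LongPowerSeries) →ₗ[LongPowerSeries] LongPowerSeries)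

theorem truncOp_apply (S : ℤ → Finset ℤ) (x : ℤ → LongPowerSeries) (n : ℤ) :
    truncOp e S x n = ∑ m ∈ S n, qPow (e n m) * x (n - m) := by
  simp [truncOp, LinearMap.sum_apply]

theorem thetaOp_mem_ordSub (he : ∀ n, IsThetaExp (e n)) (c : ℕ) (x : ℤ → LongPowerSeries)
    (hx : x ∈ ordSub ℤ c) : thetaOp e he x ∈ ordSub ℤ c := by
  refine mem_ordSub.2 fun n => ?_
  have h := thetaSum_sub_sum_mem (he n) (x := fun m => x (n - m)) (d := 0)
    (fun m => mem_ordSub.1 hx _) ∅ fun m _ => by simpa using (he n).nonneg m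
  simpa [thetaOp_apply] using h

theorem thetaOp_sub_truncOp_mem_ordSub (he : ∀ n, IsThetaExp (e n)) (S : ℤ → Finset ℤ)
    (hS : ∀ n, ∀ m ∉ S n, 1 ≤ e n m) (c : ℕ) (x : ℤ → LongPowerSeries) (hx : x ∈ ordSub ℤ c) :
    thetaOp e he x - truncOp e S x ∈ ordSub ℤ (c + 1) := by
  refine mem_ordSub.2 fun n => ?_
  rw [Pi.sub_apply, truncOp_apply, thetaOp_apply]
  exact thetaSum_sub_sum_mem (he n) (fun m => mem_ordSub.1 hx _) (S n)
    fun m hm => by simpa using hS n m hm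

/-- A two-sided sequence can be defined by recursion in both directions. -/
theorem exists_two_sided_recursion {R : Type*} (k : ℤ) (a : R) (F G : ℤ → R → R) :
    ∃ x : ℤ → R, x k = a ∧ (∀ n, k ≤ n → x (n + 1) = F n (x n)) ∧
      ∀ n, n ≤ k → x (n - 1) = G n (x n) :=
  ⟨fun n => Int.inductionOn' (motive := fun _ => R) n k a (fun n _ => F n) fun n _ => G n,
    Int.inductionOn'_self, fun _ => Int.inductionOn'_add_one, fun _ => Int.inductionOn'_sub_one⟩

/-- Suppose that, up to higher order, the operator is `x_n + q ^ e(n, 1) x_{n - 1}` for `n > k`,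
`x_n + q ^ e(n, -1) x_{n + 1}` for `n < k`, and `x_k` for `n = k`. These terms can be inverted by
recursion in both directions from `k`, so the operator is bijective. -/
theorem thetaOp_bijective (he : ∀ n, IsThetaExp (e n)) (k : ℤ) (h0 : ∀ n, e n 0 = 0)
    (h1 : ∀ n, n ≤ k → 1 ≤ e n 1) (h2 : ∀ n, k ≤ n → 1 ≤ e n (-1)) :
    Function.Bijective (thetaOp e he) := by
  -- `S n` holds the indices `m` of the terms that may have an exponent below `1`.
  let S : ℤ → Finset ℤ := fun n => if k < n then {0, 1} else if n < k then {0, -1} else {0}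
  have hS : ∀ n, ∀ m ∉ S n, 1 ≤ e n m := by
    intro n m hm
    by_cases hm2 : 2 ≤ |m|
    · linarith [(he n).two_le hm2]
    · have hm3 : m = 0 ∨ m = 1 ∨ m = -1 := by grind
      rcases hm3 with rfl | rfl | rfl
      · exfalso; revert hm; simp only [S]; split_ifs <;> simp
      · refine h1 n (not_lt.1 fun hn => hm ?_)
        simp [S, hn]
      · refine h2 n (not_lt.1 fun hn => hm ?_)
        simp [S, hn, not_lt.2 hn.le]
  have hk : ∀ x, truncOp e S x k = x k := fun x => by
    simp [truncOp_apply, S, h0, qPow_zero]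
  have hup : ∀ x n, k ≤ n →
      truncOp e S x (n + 1) = x (n + 1) + qPow (e (n + 1) 1) * x n := fun x n hn => by
    simp [truncOp_apply, S, h0, qPow_zero, show k < n + 1 by lia]
  have hdown : ∀ x n, n ≤ k →
      truncOp e S x (n - 1) = x (n - 1) + qPow (e (n - 1) (-1)) * x n := fun x n hn => by
    simp [truncOp_apply, S, h0, qPow_zero, show n - 1 < k by lia, show ¬ k < n - 1 by lia]
  have hord : ∀ x c, truncOp e S x ∈ ordSub ℤ c → x ∈ ordSub ℤ c := by
    intro x c hx
    refine mem_ordSub.2 fun n => ?_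
    induction n using Int.inductionOn' (b := k) with
    | zero => exact hk x ▸ mem_ordSub.1 hx k
    | succ n hn ih =>
      have h := Ideal.sub_mem _ (mem_ordSub.1 hx (n + 1))
        (Ideal.mul_mem_left _ (qPow (e (n + 1) 1)) ih)
      rwa [hup x n hn, add_sub_cancel_right] at h
    | pred n hn ih =>
      have h := Ideal.sub_mem _ (mem_ordSub.1 hx (n - 1))
        (Ideal.mul_mem_left _ (qPow (e (n - 1) (-1))) ih)
      rwa [hdown x n hn, add_sub_cancel_right] at h
  constructor
  · refine (injective_iff_map_eq_zero _).2 fun x hx => ?_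
    exact eq_zero_of_approx (fun _ => True) (thetaOp_sub_truncOp_mem_ordSub he S hS)
      (fun x _ c => hord x c) trivial hx
  · refine surjective_of_approx (thetaOp_mem_ordSub he)
      (thetaOp_sub_truncOp_mem_ordSub he S hS) fun y => ?_
    obtain ⟨x, hx0, hx1, hx2⟩ := exists_two_sided_recursion k (y k)
      (fun n r => y (n + 1) - qPow (e (n + 1) 1) * r)
      (fun n r => y (n - 1) - qPow (e (n - 1) (-1)) * r)
    have hxy : truncOp e S x = y := by
      funext n
      induction n using Int.inductionOn' (b := k) with
      | zero => rw [hk, hx0]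
      | succ n hn ih => rw [hup x n hn, hx1 n hn, sub_add_cancel]
      | pred n hn ih => rw [hdown x n hn, hx2 n hn, sub_add_cancel]
    exact ⟨x, hxy, fun c hc => hord x c (hxy ▸ hc)⟩


theorem truncOp_pair_apply (h : ∀ n m : ℤ, e n m = m * (m - 1))
    (x : ℤ → LongPowerSeries) (n : ℤ) :
    truncOp e (fun _ => {0, 1}) x n = x n + x (n - 1) := by
  simp [truncOp_apply, h, qPow_zero]

theorem one_le_of_notMem_pair (h : ∀ n m : ℤ, e n m = m * (m - 1)) (n m : ℤ)
    (hm : m ∉ ({0, 1} : Finset ℤ)) : 1 ≤ e n m := by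
  rw [h]
  have h' : (1 : ℤ) ≤ m * (m - 1) := by
    simp only [Finset.mem_insert, Finset.mem_singleton, not_or] at hm
    rcases lt_or_ge m 0 with h0 | h0
    · nlinarith
    · have : 2 ≤ m := by lia
      nlinarith
  exact_mod_cast h'

/-- For the exponents `m (m - 1)`, the operator is `x_n + x_{n - 1}` up to higher order, and hence
surjective. -/
theorem thetaOp_surjective_of_constant (he : ∀ n, IsThetaExp (e n))
    (h : ∀ n m : ℤ, e n m = m * (m - 1)) : Function.Surjective (thetaOp e he) := by
  refine surjective_of_approx (thetaOp_mem_ordSub he)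
    (thetaOp_sub_truncOp_mem_ordSub he _ (one_le_of_notMem_pair h)) fun y => ?_
  obtain ⟨x, hx0, hx1, hx2⟩ := exists_two_sided_recursion (0 : ℤ) (0 : LongPowerSeries)
    (fun n r => y (n + 1) - r) (fun n r => y n - r)
  refine ⟨x, ?_, fun c hc => mem_ordSub.2 fun n => ?_⟩
  · funext n
    rw [truncOp_pair_apply h]
    rcases lt_or_ge 0 n with hn | hn
    · have h1 := hx1 (n - 1) (by lia)
      rw [sub_add_cancel] at h1
      rw [h1, sub_add_cancel]
    · rw [hx2 n hn, add_sub_cancel]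
  · induction n using Int.inductionOn' (b := 0) with
    | zero => rw [hx0]; exact Ideal.zero_mem _
    | succ n hn ih => rw [hx1 n hn]; exact Ideal.sub_mem _ (mem_ordSub.1 hc _) ih
    | pred n hn ih => rw [hx2 n hn]; exact Ideal.sub_mem _ (mem_ordSub.1 hc _) ih

/-- For the exponents `m (m - 1)`, the kernel of the operator consists of constant sequences. -/
theorem eq_const_of_thetaOp_eq_zero (he : ∀ n, IsThetaExp (e n))
    (h : ∀ n m : ℤ, e n m = m * (m - 1)) {x : ℤ → LongPowerSeries}
    (hx : thetaOp e he x = 0) (n : ℤ) :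
    x n = x 0 := by
  have hc : thetaOp e he (fun _ => x 0) = 0 := by
    funext n
    refine thetaSum_const (he n) (fun m => ?_) _
    rw [h, h]
    push_cast
    ring
  have hz : (x - fun _ => x 0) = 0 := by
    refine eq_zero_of_approx (B := thetaOp e he) (fun z => z 0 = 0)
      (thetaOp_sub_truncOp_mem_ordSub he _ (one_le_of_notMem_pair h)) ?_
      (sub_self (x 0)) (by rw [map_sub, hx, hc, sub_zero])
    intro z hz0 c hz
    refine mem_ordSub.2 fun n => ?_
    have hmem := fun n => mem_ordSub.1 hz n
    simp only [truncOp_pair_apply h] at hmem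
    induction n using Int.inductionOn' (b := 0) with
    | zero => rw [hz0]; exact Ideal.zero_mem _
    | succ n hn ih =>
      have h1 := Ideal.sub_mem _ (hmem (n + 1)) ih
      rwa [add_sub_cancel_right, add_sub_cancel_right] at h1
    | pred n hn ih =>
      have h1 := Ideal.sub_mem _ (hmem n) ih
      rwa [add_sub_cancel_left] at h1
  exact sub_eq_zero.1 (congrFun hz n)

end LongPowerSeries

namespace PlumbingGraph

open LongPowerSeries

section minima

variable {V : Type u}

/-! ### The minima `g[K, E]` -/

theorem g_empty (Γ : PlumbingGraph V) (K : V → ℤ) : Γ.g K ∅ = 0 := by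
  simp [g, f]

theorem g_congr (Γ : PlumbingGraph V) {K K' : V → ℤ} {E : Finset V} (h : ∀ u ∈ E, K u = K' u) :
    Γ.g K E = Γ.g K' E := by
  refine Finset.inf'_congr _ rfl fun I hI => ?_
  rw [f, f, Finset.sum_congr rfl fun u hu => h u (Finset.mem_powerset.1 hI hu)]

theorem g_le (Γ : PlumbingGraph V) (K : V → ℤ) {I E : Finset V} (h : I ⊆ E) :
    Γ.g K E ≤ Γ.f K I :=
  Finset.inf'_le _ (Finset.mem_powerset.2 h)

theorem exists_g_eq (Γ : PlumbingGraph V) (K : V → ℤ) (E : Finset V) :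
    ∃ I ⊆ E, Γ.g K E = Γ.f K I := by
  obtain ⟨I, hI, h⟩ := Finset.exists_mem_eq_inf' (s := E.powerset)
    ⟨∅, Finset.empty_mem_powerset _⟩ (Γ.f K)
  exact ⟨I, Finset.mem_powerset.1 hI, h⟩

variable [DecidableEq V]

/-- The minimum over subsets of `E ∪ w` is attained with or without `w`. -/
theorem g_insert (Γ : PlumbingGraph V) (K : V → ℤ) {w : V} {E : Finset V} (hw : w ∉ E) :
    Γ.g K (insert w E) =
      min (Γ.g K E) (Γ.g (K + (2 : ℤ) • Γ.dual w) E + ((K w + Γ.inter w w : ℤ) : ℝ) / 2) := by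
  apply le_antisymm
  · refine le_min ?_ ?_
    · obtain ⟨I, hI, h⟩ := Γ.exists_g_eq K E
      exact h ▸ Γ.g_le K (hI.trans (Finset.subset_insert _ _))
    · obtain ⟨I, hI, h⟩ := Γ.exists_g_eq (K + (2 : ℤ) • Γ.dual w) E
      rw [h, ← Γ.f_insert K fun hwI => hw (hI hwI)]
      exact Γ.g_le K (Finset.insert_subset_insert w hI)
  · obtain ⟨I, hI, h⟩ := Γ.exists_g_eq K (insert w E)
    rw [h]
    by_cases hwI : w ∈ I
    · refine min_le_of_right_le ?_
      rw [← Finset.insert_erase hwI, Γ.f_insert K (Finset.notMem_erase w I)]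
      have := Γ.g_le (K + (2 : ℤ) • Γ.dual w) (Finset.subset_insert_iff.1 hI)
      linarith
    · exact min_le_of_left_le (Γ.g_le K ((Finset.subset_insert_iff_of_notMem hwI).1 hI))

theorem g_add_single_of_notMem (Γ : PlumbingGraph V) (K : V → ℤ) {v : V} {E : Finset V}
    (hv : v ∉ E) (j : ℤ) : Γ.g (K + Pi.single v j) E = Γ.g K E := by
  refine Γ.g_congr fun u hu => ?_
  have huv : u ≠ v := fun h => hv (h ▸ hu)
  rw [Pi.add_apply, Pi.single_eq_of_ne huv, add_zero]

/-- As the value of `K` at `v ∈ E` varies, the sets `I` without `v` contribute a constant to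
`g[K, E]`, and those with `v` an affine function of slope `1 / 2`. -/
theorem exists_g_add_single_eq_min (Γ : PlumbingGraph V) (K : V → ℤ) {v : V} {E : Finset V}
    (hv : v ∈ E) :
    ∃ α β : ℝ, ∀ n : ℤ, Γ.g (K + Pi.single v (2 * n)) E = min α (β + n) := by
  refine ⟨Γ.g K (E.erase v),
    Γ.g (K + (2 : ℤ) • Γ.dual v) (E.erase v) + ((K v + Γ.inter v v : ℤ) : ℝ) / 2, fun n => ?_⟩
  have h := Γ.g_insert (K + Pi.single v (2 * n)) (Finset.notMem_erase v E)
  rw [Finset.insert_erase hv, add_right_comm, Γ.g_add_single_of_notMem _ (Finset.notMem_erase v E),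
    Γ.g_add_single_of_notMem _ (Finset.notMem_erase v E)] at h
  rw [h, Pi.add_apply, Pi.single_eq_same]
  congr 1
  push_cast
  ring

theorem g_add_single_le (Γ : PlumbingGraph V) (K : V → ℤ) (v : V) (E : Finset V) {n n' : ℤ}
    (h : n ≤ n') :
    Γ.g (K + Pi.single v (2 * n)) E ≤ Γ.g (K + Pi.single v (2 * n')) E ∧
      Γ.g (K + Pi.single v (2 * n')) E ≤ Γ.g (K + Pi.single v (2 * n)) E + (n' - n) := by
  have h' : (n : ℝ) ≤ n' := by exact_mod_cast h
  by_cases hv : v ∈ E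
  · obtain ⟨α, β, hαβ⟩ := Γ.exists_g_add_single_eq_min K hv
    rw [hαβ, hαβ]
    refine ⟨min_le_min_left _ (by linarith), ?_⟩
    rw [← min_add_add_right]
    exact min_le_min (by linarith) (by linarith)
  · simp only [Γ.g_add_single_of_notMem _ hv]
    exact ⟨le_rfl, by linarith⟩

theorem plusOne_inter (Γ : PlumbingGraph V) (v u w : V) : (Γ.plusOne v).inter u w =
    Γ.inter u w + Pi.single (M := fun _ => ℤ) v (Pi.single (M := fun _ => ℤ) v 1 w) u := by
  by_cases huw : u = w
  · subst huw
    by_cases hu : u = v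
    · subst hu; simp [inter, plusOne]
    · simp [inter, plusOne, hu]
  · by_cases hu : u = v
    · subst hu; simp [inter, plusOne, huw, Ne.symm huw]; rfl
    · simp [inter, plusOne, huw, hu]; rfl

/-- Raising the framing of `v` by one has the effect of raising `K(v)` by one. -/
theorem plusOne_f (Γ : PlumbingGraph V) (v : V) (K : V → ℤ) (I : Finset V) :
    (Γ.plusOne v).f K I = Γ.f (K + Pi.single v 1) I := by
  simp only [f, plusOne_inter, Pi.add_apply, Finset.sum_add_distrib]
  refine congrArg (fun z : ℤ => (z : ℝ) / 2) ?_
  rw [Finset.sum_comm (f := fun u w =>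
    Pi.single (M := fun _ => ℤ) v (Pi.single (M := fun _ => ℤ) v 1 w) u)]
  simp only [Finset.sum_pi_single']
  split_ifs with h
  · rw [Finset.sum_pi_single', if_pos h]; ring
  · simp

theorem plusOne_g (Γ : PlumbingGraph V) (v : V) (K : V → ℤ) (E : Finset V) :
    (Γ.plusOne v).g K E = Γ.g (K + Pi.single v 1) E :=
  Finset.inf'_congr _ rfl fun I _ => Γ.plusOne_f v K I

theorem plusOne_tg (Γ : PlumbingGraph V) (v : V) (t : ℝ) (K : V → ℤ) (E : Finset V) :
    (Γ.plusOne v).tg t K E = Γ.tg t (K + Pi.single v 1) E := by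
  rw [tg, tg, plusOne_g, plusOne_g, add_right_comm K]
  rfl

theorem delete_inter (Γ : PlumbingGraph V) (v : V) (w u : {w : V // w ≠ v}) :
    (Γ.delete v).inter w u = Γ.inter w.1 u.1 := by
  by_cases h : w = u
  · simp [inter, delete, h]
  · simp [inter, delete, h, Subtype.ext_iff.not.1 h]
    rfl

theorem delete_g (Γ : PlumbingGraph V) (v : V) (K : V → ℤ) (E : Finset {w : V // w ≠ v}) :
    (Γ.delete v).g (fun w => K w.1) E = Γ.g K (E.map (Function.Embedding.subtype _)) := by
  induction E using Finset.induction_on generalizing K with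
  | empty => rw [Finset.map_empty, g_empty, g_empty]
  | insert w E hw ih =>
    have hw' : w.1 ∉ E.map (Function.Embedding.subtype _) := by simpa using fun _ => hw
    have hdual : (fun u : {w : V // w ≠ v} => K u.1) + (2 : ℤ) • (Γ.delete v).dual w =
        fun u => (K + (2 : ℤ) • Γ.dual w.1) u.1 := by
      funext u
      simp only [Pi.add_apply, Pi.smul_apply, dual, delete_inter]
    rw [Finset.map_insert, Function.Embedding.subtype_apply, g_insert _ _ hw, g_insert _ _ hw',
      hdual, ih, ih, delete_inter]

theorem delete_tg (Γ : PlumbingGraph V) (v : V) (t : ℝ) (K : V → ℤ)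
    (E : Finset {w : V // w ≠ v}) :
    (Γ.delete v).tg t (fun w => K w.1) E = Γ.tg t K (E.map (Function.Embedding.subtype _)) := by
  rw [tg, tg, ← delete_g, ← delete_g]
  rfl

/-! ### The exponents of the map onto the complex of `Γ_{+1}(v)` -/

/-- The exponents `s_m(t)` on the line of functionals `K + 2n v ^♯`, where `v ^♯` is `1` at `v` and
`0` elsewhere: the exponent for passing from position `n - m` to position `n`. -/
def lineExp (Γ : PlumbingGraph V) (v : V) (t : ℝ) (K : V → ℤ) (E : Finset V) (n m : ℤ) : ℝ :=
  Γ.tg t (K + Pi.single v (2 * n)) E - Γ.tg t (K + Pi.single v (2 * (n - m))) E + m * (m - 1)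

theorem isThetaExp_lineExp (Γ : PlumbingGraph V) (v : V) (t : Set.Icc (0 : ℝ) 2) (K : V → ℤ)
    (E : Finset V) (n : ℤ) : LongPowerSeries.IsThetaExp (Γ.lineExp v t K E n) := by
  obtain ⟨t, ht0, ht2⟩ := t
  intro m
  simp only [lineExp, tg, add_right_comm K (Pi.single v _) ((2 : ℤ) • Γ.dualZero)]
  push_cast
  rcases le_total 0 m with hm | hm
  · have h1 := (Γ.g_add_single_le K v E (show n - m ≤ n by lia)).1
    have h2 := (Γ.g_add_single_le (K + (2 : ℤ) • Γ.dualZero) v E (show n - m ≤ n by lia)).1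
    have hm' : (0 : ℝ) ≤ m := by exact_mod_cast hm
    rw [abs_of_nonneg hm']
    nlinarith [mul_le_mul_of_nonneg_left h1 (sub_nonneg.2 ht2), mul_le_mul_of_nonneg_left h2 ht0]
  · have h1 := (Γ.g_add_single_le K v E (show n ≤ n - m by lia)).2
    have h2 := (Γ.g_add_single_le (K + (2 : ℤ) • Γ.dualZero) v E (show n ≤ n - m by lia)).2
    have hm' : (m : ℝ) ≤ 0 := by exact_mod_cast hm
    rw [abs_of_nonpos hm']
    push_cast at h1 h2
    nlinarith [mul_le_mul_of_nonneg_left h1 (sub_nonneg.2 ht2), mul_le_mul_of_nonneg_left h2 ht0]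

theorem lineExp_of_notMem (Γ : PlumbingGraph V) {v : V} (t : ℝ) (K : V → ℤ) {E : Finset V}
    (hv : v ∉ E) (n m : ℤ) : Γ.lineExp v t K E n m = m * (m - 1) := by
  simp only [lineExp, tg, add_right_comm K (Pi.single v _) ((2 : ℤ) • Γ.dualZero),
    Γ.g_add_single_of_notMem _ hv]
  ring

/-- For `v ∈ E`, the function `n ↦ ᵗg[K + 2n v ^♯, E]` is concave with slopes from `2` down to `0`.
Its slope passes the value `1` at some place `k`. -/
theorem exists_one_le_lineExp (Γ : PlumbingGraph V) {v : V} (t : Set.Icc (0 : ℝ) 2) (K : V → ℤ)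
    {E : Finset V} (hv : v ∈ E) :
    ∃ k : ℤ, (∀ n, n ≤ k → 1 ≤ Γ.lineExp v t K E n 1) ∧
      ∀ n, k ≤ n → 1 ≤ Γ.lineExp v t K E n (-1) := by
  obtain ⟨t, ht0, ht2⟩ := t
  obtain ⟨α, β, h1⟩ := Γ.exists_g_add_single_eq_min K hv
  obtain ⟨α', β', h2⟩ := Γ.exists_g_add_single_eq_min (K + (2 : ℤ) • Γ.dualZero) hv
  -- the slope of `min a (b + n)` between `n - 1` and `n`
  let s : ℝ → ℝ → ℤ → ℝ := fun a b n => min a (b + n) - min a (b + n - 1)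
  have hs : ∀ a b n n', n ≤ n' → s a b n' ≤ s a b n := by
    intro a b n n' h
    have h' : (n : ℝ) ≤ n' := by exact_mod_cast h
    simp only [s, min_def]
    split_ifs <;> linarith
  have hs1 : ∀ a b (n : ℤ), (n : ℝ) ≤ a - b → s a b n = 1 := by
    intro a b n h
    simp only [s]
    rw [min_eq_right (by linarith), min_eq_right (by linarith)]
    ring
  have hs0 : ∀ a b (n : ℤ), a - b ≤ (n : ℝ) - 1 → s a b n = 0 := by
    intro a b n h
    simp only [s]
    rw [min_eq_left (by linarith), min_eq_left (by linarith), sub_self]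
  let σ : ℤ → ℝ := fun n => (2 - t) * s α β n + t * s α' β' n
  have hσ : ∀ n n', n ≤ n' → σ n' ≤ σ n := fun n n' h =>
    add_le_add (mul_le_mul_of_nonneg_left (hs _ _ _ _ h) (sub_nonneg.2 ht2))
      (mul_le_mul_of_nonneg_left (hs _ _ _ _ h) ht0)
  have he1 : ∀ n, Γ.lineExp v t K E n 1 = σ n := by
    intro n
    simp only [lineExp, tg, add_right_comm K (Pi.single v _) ((2 : ℤ) • Γ.dualZero), h1, h2, σ, s]
    push_cast
    rw [← add_sub_assoc β, ← add_sub_assoc β']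
    ring
  have he2 : ∀ n, Γ.lineExp v t K E n (-1) = 2 - σ (n + 1) := by
    intro n
    simp only [lineExp, tg, add_right_comm K (Pi.single v _) ((2 : ℤ) • Γ.dualZero), h1, h2, σ, s]
    push_cast
    rw [sub_neg_eq_add, ← add_assoc β, ← add_assoc β', add_sub_cancel_right, add_sub_cancel_right]
    ring
  obtain ⟨k, hk, hmax⟩ : ∃ k, 1 ≤ σ k ∧ ∀ n, 1 ≤ σ n → n ≤ k := by
    refine Int.exists_greatest_of_bdd (P := fun n => 1 ≤ σ n)
      ⟨⌈max (α - β) (α' - β') + 1⌉, fun n hn => ?_⟩ ⟨⌊min (α - β) (α' - β')⌋, ?_⟩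
    · by_contra h
      have h' := (Int.lt_ceil (α := ℝ)).not.1 (not_lt.2 (not_le.1 h).le)
      rw [not_lt] at h'
      have ha := le_max_left (α - β) (α' - β')
      have hb := le_max_right (α - β) (α' - β')
      have : σ n = 0 := by
        simp only [σ]
        rw [hs0 _ _ _ (by linarith), hs0 _ _ _ (by linarith)]
        ring
      linarith
    · have h' := Int.floor_le (min (α - β) (α' - β'))
      have ha := min_le_left (α - β) (α' - β')
      have hb := min_le_right (α - β) (α' - β')
      simp only [σ]
      rw [hs1 _ _ _ (by linarith), hs1 _ _ _ (by linarith)]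
      linarith
  refine ⟨k, fun n hn => ?_, fun n hn => ?_⟩
  · rw [he1]
    exact hk.trans (hσ n k hn)
  · rw [he2]
    have h : ¬ 1 ≤ σ (n + 1) := fun h => by have := hmax _ h; lia
    linarith

end minima

section maps

variable {V : Type u} [DecidableEq V]

/-! ### Characteristic vectors of `G`, `G - v` and `G_{+1}(v)` -/

section Char

variable {Γ : PlumbingGraph V} {v : V}

/-- The extension of a characteristic vector of `G - v` to `G` whose value at `v` is the framing
of `v` plus `2n`. -/
def Char.extend (K : (Γ.delete v).Char) (n : ℤ) : Γ.Char :=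
  ⟨fun u => if h : u = v then Γ.framing v + 2 * n else K.1 ⟨u, h⟩, fun u => by
    by_cases h : u = v
    · subst h
      simp [inter, Int.ModEq]
    · have h' := K.2 ⟨u, h⟩
      rw [delete_inter] at h'
      simpa [h] using h'⟩

theorem Char.extend_apply_self (K : (Γ.delete v).Char) (n : ℤ) :
    (K.extend n).1 v = Γ.framing v + 2 * n := by
  simp [Char.extend]

theorem Char.extend_apply_of_ne (K : (Γ.delete v).Char) (n : ℤ) {u : V} (h : u ≠ v) :
    (K.extend n).1 u = K.1 ⟨u, h⟩ := by
  simp [Char.extend, h]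

theorem Char.restrict_extend (K : (Γ.delete v).Char) (n : ℤ) : (K.extend n).restrict v = K :=
  Subtype.ext (funext fun u => K.extend_apply_of_ne n u.2)

theorem Char.exists_eq_extend (K : Γ.Char) (v : V) : ∃ n, K = (K.restrict v).extend n := by
  have h := K.2 v
  simp only [inter, if_true] at h
  obtain ⟨n, hn⟩ := h.symm.dvd
  refine ⟨n, Subtype.ext (funext fun u => ?_)⟩
  by_cases hu : u = v
  · subst hu
    rw [Char.extend_apply_self]
    linarith
  · rw [Char.extend_apply_of_ne _ _ hu]
    rfl

theorem Char.extend_eq_add_single (K : (Γ.delete v).Char) (n : ℤ) :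
    (K.extend n).1 = (K.extend 0).1 + Pi.single v (2 * n) := by
  funext u
  by_cases hu : u = v
  · subst hu
    rw [Pi.add_apply, Pi.single_eq_same, extend_apply_self, extend_apply_self]
    ring
  · rw [Pi.add_apply, Pi.single_eq_of_ne hu, extend_apply_of_ne _ _ hu, extend_apply_of_ne _ _ hu,
      add_zero]

/-- The characteristic vector of `G_{+1}(v)` that is obtained from one of `G` by lowering the value
at `v` by one. -/
def Char.toPlusOne (K : Γ.Char) (v : V) : (Γ.plusOne v).Char :=
  ⟨K.1 - Pi.single v 1, fun w => by
    have h := K.2 w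
    rw [plusOne_inter, Pi.sub_apply]
    by_cases hw : w = v
    · subst hw
      simp only [Pi.single_eq_same]
      unfold Int.ModEq at h ⊢
      omega
    · rwa [Pi.single_eq_of_ne hw, Pi.single_eq_of_ne hw, sub_zero, add_zero]⟩

theorem Char.toPlusOne_lower_zero (K' : (Γ.plusOne v).Char) : (K'.lower 0).toPlusOne v = K' := by
  apply Subtype.ext
  simp [Char.lower, Char.toPlusOne, Pi.single_neg]

theorem Char.lower_toPlusOne_extend (K : (Γ.delete v).Char) (n m : ℤ) :
    ((K.extend n).toPlusOne v).lower m = K.extend (n - m) := by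
  apply Subtype.ext
  funext u
  by_cases hu : u = v
  · subst hu
    simp only [Char.lower, Char.toPlusOne, Pi.sub_apply, Pi.single_eq_same, extend_apply_self]
    ring
  · simp only [Char.lower, Char.toPlusOne, Pi.sub_apply, Pi.single_eq_of_ne hu,
      extend_apply_of_ne _ _ hu, sub_zero]

theorem Char.exists_eq_toPlusOne_extend (K' : (Γ.plusOne v).Char) :
    ∃ (K : (Γ.delete v).Char) (n : ℤ), K' = (K.extend n).toPlusOne v := by
  obtain ⟨n, hn⟩ := (K'.lower 0).exists_eq_extend v
  exact ⟨_, n, by rw [← hn, K'.toPlusOne_lower_zero]⟩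

/-- The two ways of passing from `G_{+1}(v)` to `G` and subtracting `2 w ^*` are compatible. For
`w = v` the index is shifted by one, because `v · v` differs by one in the two graphs. -/
theorem Char.lower_addDual (K' : (Γ.plusOne v).Char) (w : V) (m : ℤ) :
    (K'.addDual (-1) w).lower m = (K'.lower (m + if w = v then 1 else 0)).addDual (-1) w := by
  apply Subtype.ext
  funext u
  simp only [Char.lower, Char.addDual, dual, plusOne_inter, Pi.sub_apply, Pi.add_apply,
    Pi.smul_apply, smul_eq_mul]
  by_cases hw : w = v
  · subst hw
    by_cases hu : u = w
    · subst hu; simp only [Pi.single_eq_same, if_true]; ring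
    · simp only [Pi.single_eq_same, Pi.single_eq_of_ne hu, if_true]; ring
  · simp only [Pi.single_eq_of_ne hw, if_neg hw, add_zero]; ring

end Char

theorem sExp_eq_lineExp (Γ : PlumbingGraph V) (v : V) (t : ℝ) (K : (Γ.delete v).Char)
    (E : Finset V) (n m : ℤ) :
    Γ.sExp v t m (((K.extend n).toPlusOne v).lower m).1 ((K.extend n).toPlusOne v).1 E =
      Γ.lineExp v t (K.extend 0).1 E n m := by
  rw [sExp, lineExp, plusOne_tg, Char.lower_toPlusOne_extend, ← Char.extend_eq_add_single,
    ← Char.extend_eq_add_single]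
  simp [Char.toPlusOne]

theorem isThetaExp_sExp (Γ : PlumbingGraph V) (v : V) (t : Set.Icc (0 : ℝ) 2)
    (K' : (Γ.plusOne v).Char) (E : Finset V) :
    IsThetaExp fun m => Γ.sExp v t m (K'.lower m).1 K'.1 E := by
  obtain ⟨K, n, rfl⟩ := K'.exists_eq_toPlusOne_extend
  simp only [sExp_eq_lineExp]
  exact Γ.isThetaExp_lineExp v t _ E n

/-! ### The maps on formal sums of generators -/

/-- The map `[K, E] ↦ ∑_j [(K, j), E]` on formal sums: the coefficient at a generator with `v ∉ E`
is that of its restriction to `G - v`, and the coefficient at one with `v ∈ E` is zero. -/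
def mapA (Γ : PlumbingGraph V) (v : V) :
    ((Γ.delete v).Gen → LongPowerSeries) →ₗ[LongPowerSeries] (Γ.Gen → LongPowerSeries) where
  toFun x y := if v ∈ y.2 then 0 else x (y.1.restrict v, y.2.subtype (· ≠ v))
  map_add' x x' := by
    funext y
    simp only [Pi.add_apply]
    split_ifs <;> simp
  map_smul' r x := by
    funext y
    simp only [Pi.smul_apply, RingHom.id_apply]
    split_ifs <;> simp

theorem mapA_apply (Γ : PlumbingGraph V) (v : V) (x : (Γ.delete v).Gen → LongPowerSeries)
    (K : Γ.Char) (E : Finset V) :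
    Γ.mapA v x (K, E) = if v ∈ E then 0 else x (K.restrict v, E.subtype (· ≠ v)) := rfl

/-- The map `[(K, j), E] ↦ ∑_m q ^ s_m(t) [(K, j + 2m - 1), E]` on formal sums: the coefficient at
`[K', E]` collects the contributions of the generators `[K'.lower m, E]`. -/
def mapB (Γ : PlumbingGraph V) (v : V) (t : Set.Icc (0 : ℝ) 2) :
    (Γ.Gen → LongPowerSeries) →ₗ[LongPowerSeries] ((Γ.plusOne v).Gen → LongPowerSeries) :=
  LinearMap.pi fun y => (thetaSum _ (Γ.isThetaExp_sExp v t y.1 y.2)).comp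
    (LinearMap.funLeft LongPowerSeries LongPowerSeries fun m => ((y.1.lower m, y.2) : Γ.Gen))

theorem mapB_apply (Γ : PlumbingGraph V) (v : V) (t : Set.Icc (0 : ℝ) 2)
    (x : Γ.Gen → LongPowerSeries) (K' : (Γ.plusOne v).Char) (E : Finset V) :
    Γ.mapB v t x (K', E) =
      thetaSum _ (Γ.isThetaExp_sExp v t K' E) fun m => x (K'.lower m, E) := rfl

theorem mapB_congr (Γ : PlumbingGraph V) (v : V) (t : Set.Icc (0 : ℝ) 2)
    {x x' : Γ.Gen → LongPowerSeries} {E : Finset V} (h : ∀ K, x (K, E) = x' (K, E))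
    (K' : (Γ.plusOne v).Char) : Γ.mapB v t x (K', E) = Γ.mapB v t x' (K', E) := by
  rw [mapB_apply, mapB_apply]
  exact thetaSum_congr _ _ (fun _ => rfl) fun m => h _

/-- The generators over a fixed `K` on `G - v` and a fixed `E` form a line, on which the map is an
operator of theta type. -/
theorem mapB_extend (Γ : PlumbingGraph V) (v : V) (t : Set.Icc (0 : ℝ) 2)
    (x : Γ.Gen → LongPowerSeries) (K : (Γ.delete v).Char) (E : Finset V) (n : ℤ) :
    Γ.mapB v t x ((K.extend n).toPlusOne v, E) =
      thetaOp _ (Γ.isThetaExp_lineExp v t (K.extend 0).1 E) (fun n => x (K.extend n, E)) n := by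
  rw [mapB_apply, thetaOp_apply]
  exact thetaSum_congr _ _ (fun m => Γ.sExp_eq_lineExp v t K E n m)
    fun m => by rw [Char.lower_toPlusOne_extend]

/-! ### Exactness on formal sums -/

theorem mapA_map (Γ : PlumbingGraph V) (v : V) (x : (Γ.delete v).Gen → LongPowerSeries)
    (K : Γ.Char) (E : Finset {w : V // w ≠ v}) :
    Γ.mapA v x (K, E.map (Function.Embedding.subtype _)) = x (K.restrict v, E) := by
  rw [mapA_apply, if_neg (by simp)]
  congr 2
  ext u
  simp [u.2]

theorem mapA_injective (Γ : PlumbingGraph V) (v : V) : Function.Injective (Γ.mapA v) := by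
  intro x x' h
  funext ⟨K, E⟩
  rw [← K.restrict_extend 0, ← Γ.mapA_map v x, h, mapA_map]

theorem mapB_mapA (Γ : PlumbingGraph V) (v : V) (t : Set.Icc (0 : ℝ) 2)
    (x : (Γ.delete v).Gen → LongPowerSeries) : Γ.mapB v t (Γ.mapA v x) = 0 := by
  funext ⟨K', E⟩
  obtain ⟨K, n, rfl⟩ := K'.exists_eq_toPlusOne_extend
  rw [mapB_extend]
  by_cases hv : v ∈ E
  · have h : (fun n => Γ.mapA v x (K.extend n, E)) = 0 := by
      funext n
      rw [mapA_apply, if_pos hv]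
      rfl
    rw [h, map_zero]
    rfl
  · simp only [mapA_apply, if_neg hv, Char.restrict_extend]
    rw [thetaOp_apply]
    refine thetaSum_const _ (fun m => ?_) _
    rw [Γ.lineExp_of_notMem _ _ hv, Γ.lineExp_of_notMem _ _ hv]
    push_cast
    ring

/-- A formal sum in the kernel vanishes on the generators with `v ∈ E`, and is constant along the
lines of generators with `v ∉ E`. -/
theorem exists_mapA_eq_of_mapB_eq_zero (Γ : PlumbingGraph V) (v : V) (t : Set.Icc (0 : ℝ) 2)
    {x : Γ.Gen → LongPowerSeries} (hx : Γ.mapB v t x = 0) :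
    Γ.mapA v (fun y => x (y.1.extend 0, y.2.map (Function.Embedding.subtype _))) = x := by
  funext ⟨K, E⟩
  have hline : thetaOp _ (Γ.isThetaExp_lineExp v t ((K.restrict v).extend 0).1 E)
      (fun n => x ((K.restrict v).extend n, E)) = 0 := by
    funext n
    rw [← mapB_extend, hx]
    rfl
  obtain ⟨n, hn⟩ := K.exists_eq_extend v
  rw [mapA_apply]
  split_ifs with hv
  · obtain ⟨k, h1, h2⟩ := Γ.exists_one_le_lineExp t ((K.restrict v).extend 0).1 hv
    have h := (thetaOp_bijective (Γ.isThetaExp_lineExp v t ((K.restrict v).extend 0).1 E) k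
      (fun n => by simp [lineExp]) h1 h2).1 (hline.trans (map_zero _).symm)
    have h' := congrFun h n
    rw [← hn] at h'
    exact h'.symm
  · have h := eq_const_of_thetaOp_eq_zero _ (Γ.lineExp_of_notMem t _ hv) hline n
    rw [← hn] at h
    have hE : ∀ u ∈ E, u ≠ v := fun u hu huv => hv (huv ▸ hu)
    rw [h, Finset.subtype_map_of_mem hE]

theorem mapB_surjective (Γ : PlumbingGraph V) (v : V) (t : Set.Icc (0 : ℝ) 2) :
    Function.Surjective (Γ.mapB v t) := by
  intro y
  have hline : ∀ (K : (Γ.delete v).Char) (E : Finset V), ∃ z : ℤ → LongPowerSeries,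
      thetaOp _ (Γ.isThetaExp_lineExp v t (K.extend 0).1 E) z =
        fun n => y ((K.extend n).toPlusOne v, E) := by
    intro K E
    by_cases hv : v ∈ E
    · obtain ⟨k, h1, h2⟩ := Γ.exists_one_le_lineExp t (K.extend 0).1 hv
      exact (thetaOp_bijective _ k (fun n => by simp [lineExp]) h1 h2).2 _
    · exact thetaOp_surjective_of_constant _ (Γ.lineExp_of_notMem t _ hv) _
  choose z hz using hline
  refine ⟨fun p => z (p.1.restrict v) p.2 ((p.1.1 v - Γ.framing v) / 2), ?_⟩
  funext ⟨K', E⟩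
  obtain ⟨K, n, rfl⟩ := K'.exists_eq_toPlusOne_extend
  rw [mapB_extend]
  simp only [Char.restrict_extend, Char.extend_apply_self, add_sub_cancel_left]
  simp only [ne_eq, OfNat.ofNat_ne_zero, not_false_eq_true, Int.mul_ediv_cancel_left]
  exact congrFun (hz K E) n

end maps

/-! ### The maps commute with the differentials -/

section bdry

variable {V : Type u} [DecidableEq V]

theorem Char.restrict_addDual {Γ : PlumbingGraph V} {v : V} (K : Γ.Char) (n : ℤ)
    (w : {w : V // w ≠ v}) :
    (K.addDual n w.1).restrict v = (K.restrict v).addDual n w := by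
  apply Subtype.ext
  funext u
  simp only [Char.restrict, Char.addDual, dual, Pi.add_apply, Pi.smul_apply, delete_inter]

theorem mapA_mem_chains (Γ : PlumbingGraph V) (v : V) (p : ℤ)
    (x : (Γ.delete v).Gen → LongPowerSeries) (hx : x ∈ (Γ.delete v).chains p) :
    Γ.mapA v x ∈ Γ.chains p := by
  rintro ⟨K, E⟩ hE
  rw [mapA_apply]
  split_ifs with hv
  · rfl
  · refine hx _ fun h => hE ?_
    have hE' : ∀ u ∈ E, u ≠ v := fun u hu huv => hv (huv ▸ hu)
    rw [← h]
    dsimp only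
    rw [Finset.card_subtype, Finset.filter_true_of_mem hE']

theorem mapB_mem_chains (Γ : PlumbingGraph V) (v : V) (t : Set.Icc (0 : ℝ) 2) (p : ℤ)
    (x : Γ.Gen → LongPowerSeries) (hx : x ∈ Γ.chains p) :
    Γ.mapB v t x ∈ (Γ.plusOne v).chains p := by
  rintro ⟨K', E⟩ hE
  rw [Γ.mapB_congr v t (x' := 0) fun K => hx (K, E) hE, map_zero]
  rfl

variable [Fintype V]

theorem bdry_apply (Γ : PlumbingGraph V) (t : Set.Icc (0 : ℝ) 2) (x : Γ.Gen → LongPowerSeries)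
    (K : Γ.Char) (E : Finset V) : Γ.bdry t x (K, E) = ∑ w ∈ Eᶜ,
      (qPow (Γ.ta t w K.1 (insert w E)) * x (K, insert w E) +
        qPow (Γ.tb t w (K.addDual (-1) w).1 (insert w E)) * x (K.addDual (-1) w, insert w E)) :=
  rfl

theorem bdry_mapA (Γ : PlumbingGraph V) (v : V) (t : Set.Icc (0 : ℝ) 2)
    (x : (Γ.delete v).Gen → LongPowerSeries) :
    Γ.bdry t (Γ.mapA v x) = Γ.mapA v ((Γ.delete v).bdry t x) := by
  funext ⟨K, E⟩
  rw [bdry_apply]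
  have hv0 : ∀ (K : Γ.Char) (w : V) (E : Finset V), v ∈ insert w E →
      Γ.mapA v x (K, insert w E) = 0 := fun K w E h => by rw [mapA_apply, if_pos h]
  by_cases hv : v ∈ E
  · rw [mapA_apply, if_pos hv]
    refine Finset.sum_eq_zero fun w _ => ?_
    rw [hv0 _ _ _ (Finset.mem_insert_of_mem hv), hv0 _ _ _ (Finset.mem_insert_of_mem hv),
      mul_zero, mul_zero, add_zero]
  · obtain ⟨E, rfl⟩ : ∃ E' : Finset {w : V // w ≠ v},
        E = E'.map (Function.Embedding.subtype _) := by
      have hE : ∀ u ∈ E, u ≠ v := fun u hu huv => hv (huv ▸ hu)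
      exact ⟨_, (Finset.subtype_map_of_mem hE).symm⟩
    have hcompl : (E.map (Function.Embedding.subtype _))ᶜ.erase v =
        Eᶜ.map (Function.Embedding.subtype (· ≠ v)) := by
      ext u
      by_cases hu : u = v <;> simp [hu]
    have hins : ∀ w : {w : V // w ≠ v}, insert w.1 (E.map (Function.Embedding.subtype _)) =
        (insert w E).map (Function.Embedding.subtype (· ≠ v)) := fun w => by
      rw [Finset.map_insert]; rfl
    rw [mapA_map, bdry_apply]
    refine (Finset.sum_erase (a := v) _ ?_).symm.trans ?_
    · rw [hv0 _ _ _ (Finset.mem_insert_self _ _), hv0 _ _ _ (Finset.mem_insert_self _ _),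
        mul_zero, mul_zero, add_zero]
    · rw [hcompl, Finset.sum_map]
      refine Finset.sum_congr rfl fun w hw => ?_
      have hw1 : w ∉ E := Finset.mem_compl.1 hw
      have hw2 : w.1 ∉ E.map (Function.Embedding.subtype _) := by simpa using fun _ => hw1
      have htg : ∀ (K : Γ.Char) (E : Finset {w : V // w ≠ v}),
          (Γ.delete v).tg t (K.restrict v).1 E = Γ.tg t K.1 (E.map (Function.Embedding.subtype _)) :=
        fun K E => Γ.delete_tg v t K.1 E
      rw [Function.Embedding.subtype_apply, ta_insert _ _ _ hw2, tb_insert _ _ _ hw2,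
        ta_insert _ _ _ hw1, tb_insert _ _ _ hw1, hins, mapA_map, mapA_map,
        Char.restrict_addDual, ← Char.restrict_addDual, htg, htg, htg, delete_inter]
      rfl

theorem thetaSum_qPow_mul {e e' a : ℤ → ℝ} {a' : ℝ} (he : IsThetaExp e) (he' : IsThetaExp e')
    (ha : ∀ m, 0 ≤ a m) (ha' : 0 ≤ a') (σ : ℤ ≃ ℤ) (h : ∀ m, e (σ m) + a (σ m) = a' + e' m)
    {x x' : ℤ → LongPowerSeries} (hx : ∀ m, x (σ m) = x' m) :
    thetaSum e he (fun m => qPow (a m) * x m) = qPow a' * thetaSum e' he' x' := by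
  rw [thetaSum_apply, thetaSum_apply, ← lsum_mul_left _ (he'.locFinite _),
    ← lsum_comp_equiv (he.locFinite _) σ]
  congr 1
  funext m
  rw [← mul_assoc, ← mul_assoc, qPow_mul (he.nonneg _) (ha _), qPow_mul ha' (he'.nonneg m), h, hx]

/-- The terms of both sides that remove `w` are compared for each `w` separately. The terms that also
subtract `2 w ^*` correspond after the shift of `m` in `Char.lower_addDual`. -/
theorem bdry_mapB (Γ : PlumbingGraph V) (v : V) (t : Set.Icc (0 : ℝ) 2)
    (x : Γ.Gen → LongPowerSeries) :
    (Γ.plusOne v).bdry t (Γ.mapB v t x) = Γ.mapB v t (Γ.bdry t x) := by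
  funext ⟨K', E⟩
  have hsum : (fun m => Γ.bdry t x (K'.lower m, E)) = ∑ w ∈ Eᶜ,
      ((fun m => qPow (Γ.ta t w (K'.lower m).1 (insert w E)) * x (K'.lower m, insert w E)) +
        fun m => qPow (Γ.tb t w ((K'.lower m).addDual (-1) w).1 (insert w E)) *
          x ((K'.lower m).addDual (-1) w, insert w E)) := by
    funext m
    rw [bdry_apply, Finset.sum_apply]
    rfl
  rw [mapB_apply, hsum, map_sum, bdry_apply]
  refine Finset.sum_congr rfl fun w hw => ?_
  have hw' : w ∉ E := Finset.mem_compl.1 hw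
  have ha := thetaSum_qPow_mul (Γ.isThetaExp_sExp v t K' E)
    (Γ.isThetaExp_sExp v t K' (insert w E)) (a := fun m => Γ.ta t w (K'.lower m).1 (insert w E))
    (a' := (Γ.plusOne v).ta t w K'.1 (insert w E)) (fun m => Γ.ta_nonneg t _ _ _)
    ((Γ.plusOne v).ta_nonneg t _ _ _) (Equiv.refl ℤ) ?_
    (x := fun m => x (K'.lower m, insert w E)) (x' := fun m => x (K'.lower m, insert w E))
    fun m => rfl
  have hb := thetaSum_qPow_mul (Γ.isThetaExp_sExp v t K' E)
    (Γ.isThetaExp_sExp v t (K'.addDual (-1) w) (insert w E))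
    (a := fun m => Γ.tb t w ((K'.lower m).addDual (-1) w).1 (insert w E))
    (a' := (Γ.plusOne v).tb t w (K'.addDual (-1) w).1 (insert w E))
    (fun m => Γ.tb_nonneg t _ (Finset.mem_insert_self w E))
    ((Γ.plusOne v).tb_nonneg t _ (Finset.mem_insert_self w E))
    (Equiv.addRight (if w = v then 1 else 0)) ?_
    (x := fun m => x ((K'.lower m).addDual (-1) w, insert w E))
    (x' := fun m => x ((K'.addDual (-1) w).lower m, insert w E)) ?_
  · rw [map_add, ha, hb]
    rfl
  · intro m
    simp only [Equiv.coe_addRight, sExp]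
    rw [tb_insert _ _ _ hw', tb_insert _ _ _ hw', Char.lower_addDual, plusOne_inter]
    have hz : (Γ.plusOne v).dualZero = Γ.dualZero := rfl
    by_cases hwv : w = v
    · subst hwv
      simp only [if_true, hz, Char.lower, Pi.sub_apply, Pi.single_eq_same]
      push_cast
      ring
    · simp only [if_neg hwv, hz, Char.lower, Pi.sub_apply, Pi.single_eq_of_ne hwv]
      push_cast
      ring
  · intro m
    rw [Char.lower_addDual]
    rfl
  · intro m
    simp only [Equiv.refl_apply, sExp]
    rw [ta_insert _ _ _ hw', ta_insert _ _ _ hw']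
    ring

end bdry

/-! ### The short exact sequence of complexes -/

variable {V : Type u} [Fintype V] [DecidableEq V]

/-- A map of formal sums that preserves the lattice degree and commutes with the differentials, as
a morphism of complexes. -/
def latticeMap {W : Type u} [Fintype W] [DecidableEq W] {Γ : PlumbingGraph V}
    {Γ' : PlumbingGraph W} (t : Set.Icc (0 : ℝ) 2)
    (F : (Γ.Gen → LongPowerSeries) →ₗ[LongPowerSeries] (Γ'.Gen → LongPowerSeries))
    (hF : ∀ p, ∀ x ∈ Γ.chains p, F x ∈ Γ'.chains p)
    (hd : ∀ x, Γ'.bdry t (F x) = F (Γ.bdry t x)) : Γ.latticeComplex t ⟶ Γ'.latticeComplex t where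
  f p := ModuleCat.ofHom (F.restrict (hF p))
  comm' p p' h := by
    have h' : p' + 1 = p := h
    simp only [latticeComplex, dif_pos h']
    rw [← ModuleCat.ofHom_comp, ← ModuleCat.ofHom_comp]
    exact ModuleCat.hom_ext (LinearMap.ext fun x => Subtype.ext (hd x.1))

/-- The map `A_t` of complexes. -/
def chainMapA (Γ : PlumbingGraph V) (v : V) (t : Set.Icc (0 : ℝ) 2) :
    (Γ.delete v).latticeComplex t ⟶ Γ.latticeComplex t :=
  latticeMap t (Γ.mapA v) (Γ.mapA_mem_chains v) (Γ.bdry_mapA v t)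

/-- The map `B_t` of complexes. -/
def chainMapB (Γ : PlumbingGraph V) (v : V) (t : Set.Icc (0 : ℝ) 2) :
    Γ.latticeComplex t ⟶ (Γ.plusOne v).latticeComplex t :=
  latticeMap t (Γ.mapB v t) (Γ.mapB_mem_chains v t) (Γ.bdry_mapB v t)

theorem chainMapA_comp_chainMapB (Γ : PlumbingGraph V) (v : V) (t : Set.Icc (0 : ℝ) 2) :
    Γ.chainMapA v t ≫ Γ.chainMapB v t = 0 := by
  refine HomologicalComplex.hom_ext _ _ fun p => ModuleCat.hom_ext (LinearMap.ext fun x => ?_)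
  exact Subtype.ext (Γ.mapB_mapA v t x.1)

theorem chainMapA_injective (Γ : PlumbingGraph V) (v : V) (t : Set.Icc (0 : ℝ) 2) (p : ℤ) :
    Function.Injective ((Γ.chainMapA v t).f p) := fun _ _ h =>
  Subtype.ext (Γ.mapA_injective v (congrArg Subtype.val h))

theorem chainMapB_surjective (Γ : PlumbingGraph V) (v : V) (t : Set.Icc (0 : ℝ) 2) (p : ℤ) :
    Function.Surjective ((Γ.chainMapB v t).f p) := by
  rintro ⟨y, hy⟩
  obtain ⟨x, hx⟩ := Γ.mapB_surjective v t y
  -- The map does not change `E`, so the part of degree `p` of any preimage is a preimage.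
  refine ⟨⟨fun z => if (z.2.card : ℤ) = p then x z else 0, fun z hz => if_neg hz⟩,
    Subtype.ext (funext fun z => ?_)⟩
  obtain ⟨K', E⟩ := z
  change Γ.mapB v t _ (K', E) = y (K', E)
  by_cases hE : (E.card : ℤ) = p
  · rw [← hx]
    exact Γ.mapB_congr v t (fun K => if_pos hE) K'
  · rw [hy _ hE, Γ.mapB_congr v t (x' := 0) (fun K => if_neg hE) K', map_zero]
    rfl

theorem chainMap_exact (Γ : PlumbingGraph V) (v : V) (t : Set.Icc (0 : ℝ) 2) (p : ℤ) :
    Function.Exact ((Γ.chainMapA v t).f p) ((Γ.chainMapB v t).f p) := by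
  rintro ⟨x, hx⟩
  constructor
  · intro h
    refine ⟨⟨fun y => x (y.1.extend 0, y.2.map (Function.Embedding.subtype _)), fun y hy =>
      hx _ ?_⟩, Subtype.ext (Γ.exists_mapA_eq_of_mapB_eq_zero v t (congrArg Subtype.val h))⟩
    rwa [Finset.card_map]
  · rintro ⟨z, hz⟩
    rw [← hz]
    exact Subtype.ext (Γ.mapB_mapA v t z.1)

theorem chainMap_shortExact (Γ : PlumbingGraph V) (v : V) (t : Set.Icc (0 : ℝ) 2) :
    (ShortComplex.mk _ _ (Γ.chainMapA_comp_chainMapB v t)).ShortExact := by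
  refine HomologicalComplex.shortExact_of_degreewise_shortExact _ fun p => ?_
  exact
    { exact := (ShortComplex.ShortExact.moduleCat_exact_iff_function_exact _).2
        (Γ.chainMap_exact v t p)
      mono_f := (ModuleCat.mono_iff_injective _).2 (Γ.chainMapA_injective v t p)
      epi_g := (ModuleCat.epi_iff_surjective _).2 (Γ.chainMapB_surjective v t p) }

theorem isMapA_chainMapA (Γ : PlumbingGraph V) (v : V) (t : Set.Icc (0 : ℝ) 2) :
    Γ.IsMapA v t (Γ.chainMapA v t) :=
  fun _ _ _ _ => rfl

theorem isMapB_chainMapB (Γ : PlumbingGraph V) (v : V) (t : Set.Icc (0 : ℝ) 2) :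
    Γ.IsMapB v t (Γ.chainMapB v t) := by
  refine ⟨fun K' m E => (Γ.isThetaExp_sExp v t K' E).nonneg m, fun p x K' E α => ?_⟩
  have h := (Γ.isThetaExp_sExp v t K' E).locFinite fun m => coef x (K'.lower m) E
  exact ⟨h.support_finite α, h.coeff_lsum α⟩

end PlumbingGraph

end

theorem mainTheorem3 {V : Type u} [Fintype V] [DecidableEq V] (Γ : PlumbingGraph V) (v : V)
    (hv : ¬ Γ.graph.Adj none (some v)) (t : Set.Icc (0 : ℝ) 2) :
    ∃ (A : (Γ.delete v).latticeComplex t ⟶ Γ.latticeComplex t)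
      (B : Γ.latticeComplex t ⟶ (Γ.plusOne v).latticeComplex t) (h0 : A ≫ B = 0)
      (hS : (ShortComplex.mk A B h0).ShortExact),
      Γ.IsMapA v t A ∧ Γ.IsMapB v t B ∧
      ∀ p : ℤ, ∃ δ : (Γ.plusOne v).tHFK t p ⟶ (Γ.delete v).tHFK t (p - 1),
        δ = hS.δ p (p - 1) (sub_add_cancel p 1) ∧
        Function.Exact (HomologicalComplex.homologyMap A p) (HomologicalComplex.homologyMap B p) ∧
        Function.Exact (HomologicalComplex.homologyMap B p) δ ∧
        Function.Exact δ (HomologicalComplex.homologyMap A (p - 1)) := by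
  refine ⟨Γ.chainMapA v t, Γ.chainMapB v t, Γ.chainMapA_comp_chainMapB v t,
    Γ.chainMap_shortExact v t, Γ.isMapA_chainMapA v t, Γ.isMapB_chainMapB v t,
    fun p => ⟨_, rfl, ?_, ?_, ?_⟩⟩
  · exact (ShortComplex.ShortExact.moduleCat_exact_iff_function_exact _).1
      ((Γ.chainMap_shortExact v t).homology_exact₂ p)
  · exact (ShortComplex.ShortExact.moduleCat_exact_iff_function_exact _).1
      ((Γ.chainMap_shortExact v t).homology_exact₃ p (p - 1) (sub_add_cancel p 1))
  · exact (ShortComplex.ShortExact.moduleCat_exact_iff_function_exact _).1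
      ((Γ.chainMap_shortExact v t).homology_exact₁ p (p - 1) (sub_add_cancel p 1))
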